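/- **Setting.** Let $d\ge 1$ and let $H<\mathrm{GL}(d,\mathbb R)$ be a closed subgroup, with left Haar measure $dh$, such that the dual action has an open orbit $\mathcal O=\{h^T\xi_0 : h\in H\}\subset\mathbb R^d$ of full Lebesgue measure (as is the case when the quasi-regular representation $\pi$ below is irreducible and square-integrable); write $\mathcal O^c=\mathbb R^d\setminus\mathcal O$. Let $|\cdot|$ be the Euclidean norm and $\|h\|_\infty$ the corresponding operator norm. Let $G=\mathbb R^d\rtimes H$ with product $(x,h)(y,g)=(x+hy,hg)$ and left Haar measure $d\mu_G(x,h)=|\det h|^{-1}\,dx\,dh$. For $(x,h)\in G$ let $[\pi(x,h)f](y)=|\det h|^{-1/2}f(h^{-1}(y-x))$ and $\mathcal W_\psi f(x,h)=\langle f,\pi(x,h)\psi\rangle_{L^2(\mathbb R^d)}$. The Fourier transform is $\widehat f(\xi)=\int f(x)e^{-2\pi i\langle x,\xi\rangle}dx$. A *weight* on a locally compact group $K$ is a continuous function $w:K\to(0,\infty)$ with $w(xy)\le w(x)w(y)$. For a weight $v$ on $K$ and a compact neighbourhood $U$ of the identity, $W^R(C^0,L^1_v)$ is the set of continuous $F:K\to\mathbb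 C$ with $\int_K \sup_{y\in U}|F(xy)|\,v(x)\,dx<\infty$ (left Haar measure). For a weight $v_0$ on $G$ let $$\mathcal B_{v_0}=\{\psi\in L^2(\mathbb R^d): \mathcal W_\psi\psi\in W^R(C^0,L^1_{v_0})\}.$$ For $\xi\in\mathcal O$ let $\delta(\xi)=\mathrm{dist}(\xi,\mathcal O^c)$ and $$A(\xi)=\min\Big(\frac{\delta(\xi)}{1+\sqrt{|\xi|^2-\delta(\xi)^2}},\frac1{1+|\xi|}\Big),\qquad \Phi_\ell(h)=\int_{\mathbb R^d}A(\xi)^\ell A(h^T\xi)^\ell\,d\xi\in[0,\infty]\quad(\ell\in\mathbb N_0,\ h\in H).$$ Given $s\ge0$ and a weight $w_0$ on $H$, $\mathcal O$ is *strongly $(s,w_0)$-temperately embedded with index $\ell$* if $\Phi_\ell$ is finite and belongs to $W^R(C^0,L^1_m)$ on $H$, where $m(h)=w_0(h)|\det h|^{-1/2}(1+\|h\|_\infty)^{2(s+d+1)}$. A function $f\in L^1(\mathbb R^d)$ *has vanishing moments in $\mathcal O^c$ of order $r\in\mathbb N$* if $\widehat f$ is of class $C^r$ (equivalently, all its distributional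 derivatives of order $\le r$ are continuous functions) and $\partial^\alpha\widehat f=0$ on $\mathcal O^c$ whenever $|\alpha|<r$. Put $|f|_{r,m}=\sup_{x\in\mathbb R^d,\,|\alpha|\le r}(1+|x|)^m|\partial^\alpha f(x)|$. **Theorem.** Let $s\ge 0$, let $w_0$ be a weight on $H$ and let $v_0$ be a weight on $G$ with $v_0(x,h)\le(1+|x|)^s w_0(h)$ for all $(x,h)\in G$. Assume that $\mathcal O$ is strongly $(s,w_0)$-temperately embedded with index $\ell$, and let $t\in\mathbb N$ with $t>\ell+s+d+1$. Then every $\psi\in L^1(\mathbb R^d)\cap C^{\ell+d+1}(\mathbb R^d)$ with vanishing moments in $\mathcal O^c$ of order $t$ and $|\widehat\psi|_{t,t}<\infty$ belongs to $\mathcal B_{v_0}$. Moreover, there exist nonzero compactly supported functions $\psi$ with these properties (that is, $\psi\in L^1\cap C^{\ell+d+1}$ with vanishing moments in $\mathcal O^c$ of order $t$ and $|\widehat\psi|_{t,t}<\infty$). These statements hold for every choice of the compact neighbourhoods of the identity used in the two amalgam spaces. -/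

import Mathlib

open MeasureTheory Topology FourierTransform
open scoped ENNReal

namespace WaveletCoorbit

/-- A weight on a topological group: a continuous, positive, submultiplicative function. -/
structure IsWeight {K : Type*} [Group K] [TopologicalSpace K] (w : K → ℝ) : Prop where
  continuous : Continuous w
  pos : ∀ x, 0 < w x
  submul : ∀ x y, w (x * y) ≤ w x * w y

/-- The (right) local maximum function `(M_U^R F)(x) = sup_{y ∈ U} |F(xy)|`, with values
in `[0, ∞]`. -/
noncomputable def localMax {K : Type*} [Group K] (U : Set K) (F : K → ℂ) (x : K) : ℝ≥0∞ :=
  ⨆ y ∈ U, ‖F (x * y)‖ₑ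

/-- Membership of `F` in the Wiener amalgam space `W^R(C⁰, L¹_v)` over `K` with (left Haar)
measure `μ`: `F` is continuous and `∫ (M_U^R F) v dμ < ∞`. Here `U` is a compact neighbourhood
of the identity; since `F` is continuous, `M_U^R F` is automatically measurable. -/
def MemWienerAmalgam {K : Type*} [Group K] [TopologicalSpace K] [MeasurableSpace K]
    (μ : Measure K) (U : Set K) (v : K → ℝ) (F : K → ℂ) : Prop :=
  Continuous F ∧ ∫⁻ x, localMax U F x * ENNReal.ofReal (v x) ∂μ < ∞

variable {d : ℕ}

/-- The linear map `x ↦ M x` on `ℝ^d` with the Euclidean norm; its norm is the operator norm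
`‖M‖_∞`. -/
noncomputable def euclMap (M : Matrix (Fin d) (Fin d) ℝ) :
    EuclideanSpace ℝ (Fin d) →L[ℝ] EuclideanSpace ℝ (Fin d) :=
  Matrix.toEuclideanCLM (n := Fin d) (𝕜 := ℝ) M

/-- The matrix underlying an element of the dilation group. -/
def mat {H : Subgroup (GL (Fin d) ℝ)} (h : H) : Matrix (Fin d) (Fin d) ℝ :=
  ((h : GL (Fin d) ℝ) : Matrix (Fin d) (Fin d) ℝ)

/-- `|det h|`. -/
noncomputable def absDet {H : Subgroup (GL (Fin d) ℝ)} (h : H) : ℝ := |(mat h).det|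

/-- The underlying set `ℝ^d × H` of the group `G = ℝ^d ⋊ H` of affine mappings. -/
def AffineGroup (H : Subgroup (GL (Fin d) ℝ)) : Type := EuclideanSpace ℝ (Fin d) × H

instance (H : Subgroup (GL (Fin d) ℝ)) : TopologicalSpace (AffineGroup H) :=
  inferInstanceAs (TopologicalSpace (EuclideanSpace ℝ (Fin d) × H))

instance (H : Subgroup (GL (Fin d) ℝ)) [MeasurableSpace H] : MeasurableSpace (AffineGroup H) :=
  inferInstanceAs (MeasurableSpace (EuclideanSpace ℝ (Fin d) × H))

theorem euclMap_mat_one (H : Subgroup (GL (Fin d) ℝ)) (x : EuclideanSpace ℝ (Fin d)) :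
    euclMap (mat (1 : H)) x = x := by
  simp [euclMap, mat]

theorem euclMap_mat_mul {H : Subgroup (GL (Fin d) ℝ)} (g h : H)
    (x : EuclideanSpace ℝ (Fin d)) :
    euclMap (mat (g * h)) x = euclMap (mat g) (euclMap (mat h) x) := by
  simp [euclMap, mat, map_mul]

/-- The group law `(x, h)(y, g) = (x + h y, h g)` of `G = ℝ^d ⋊ H`. -/
noncomputable instance (H : Subgroup (GL (Fin d) ℝ)) : Group (AffineGroup H) where
  mul a b := (a.1 + euclMap (mat a.2) b.1, a.2 * b.2)
  one := (0, 1)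
  inv a := (-euclMap (mat a.2⁻¹) a.1, a.2⁻¹)
  mul_assoc a b c := by
    refine Prod.ext ?_ (mul_assoc a.2 b.2 c.2)
    change (a.1 + euclMap (mat a.2) b.1) + euclMap (mat (a.2 * b.2)) c.1
      = a.1 + euclMap (mat a.2) (b.1 + euclMap (mat b.2) c.1)
    rw [euclMap_mat_mul, map_add, add_assoc]
  one_mul a := by
    refine Prod.ext ?_ (one_mul a.2)
    change 0 + euclMap (mat (1 : H)) a.1 = a.1
    rw [euclMap_mat_one, zero_add]
  mul_one a := by
    refine Prod.ext ?_ (mul_one a.2)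
    change a.1 + euclMap (mat a.2) 0 = a.1
    rw [map_zero, add_zero]
  inv_mul_cancel a := by
    refine Prod.ext ?_ (inv_mul_cancel a.2)
    change -euclMap (mat a.2⁻¹) a.1 + euclMap (mat a.2⁻¹) a.1 = 0
    rw [neg_add_cancel]

/-- The left Haar measure `|det h|⁻¹ dx dh` of `G`, where `dh = μ` is a left Haar measure
of `H`. -/
noncomputable def affineHaar {H : Subgroup (GL (Fin d) ℝ)} [MeasurableSpace H]
    (μ : Measure H) : Measure (AffineGroup H) :=
  ((volume : Measure (EuclideanSpace ℝ (Fin d))).prod μ).withDensity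
    fun p => ENNReal.ofReal (absDet p.2)⁻¹

/-- The quasi-regular representation `(π(x,h) f)(y) = |det h|^{-1/2} f(h⁻¹(y - x))`. -/
noncomputable def quasiRegular {H : Subgroup (GL (Fin d) ℝ)} (a : AffineGroup H)
    (f : EuclideanSpace ℝ (Fin d) → ℂ) (y : EuclideanSpace ℝ (Fin d)) : ℂ :=
  ((absDet a.2 ^ (-(1 / 2) : ℝ) : ℝ) : ℂ) * f (euclMap (mat a.2⁻¹) (y - a.1))

/-- The wavelet transform `(W_ψ f)(x,h) = ⟨f, π(x,h) ψ⟩`, the scalar product of `L²(ℝ^d)`. -/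
noncomputable def waveletTransform (H : Subgroup (GL (Fin d) ℝ))
    (ψ f : EuclideanSpace ℝ (Fin d) → ℂ) (a : AffineGroup H) : ℂ :=
  ∫ y, f y * (starRingEnd ℂ) (quasiRegular a ψ y)

/-- The space `B_{v₀}` of nice wavelets: `ψ ∈ L²(ℝ^d)` with `W_ψ ψ ∈ W^R(C⁰, L¹_{v₀}(G))`. -/
def MemNiceWavelets {H : Subgroup (GL (Fin d) ℝ)} [MeasurableSpace H] (μ : Measure H)
    (U : Set (AffineGroup H)) (v₀ : AffineGroup H → ℝ)
    (ψ : EuclideanSpace ℝ (Fin d) → ℂ) : Prop :=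
  MemLp ψ 2 volume ∧ MemWienerAmalgam (affineHaar μ) U v₀ (waveletTransform H ψ ψ)

/-- `O` is the open dual orbit of `H`: an orbit `{hᵀ ξ₀ : h ∈ H}` of the dual action which is
open and of full Lebesgue measure. (There is at most one such orbit.) -/
def IsOpenDualOrbit (H : Subgroup (GL (Fin d) ℝ)) (O : Set (EuclideanSpace ℝ (Fin d))) : Prop :=
  (∃ ξ₀, O = {ξ | ∃ h : H, ξ = euclMap (mat h).transpose ξ₀}) ∧ IsOpen O ∧ volume Oᶜ = 0

/-- The function `A(ξ) = min (δ / (1 + √(|ξ|² - δ²)), 1 / (1 + |ξ|))` with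
`δ = dist(ξ, Oᶜ)`. It is of interest on `O` only; off `O` this expression is `0`. -/
noncomputable def auxA (O : Set (EuclideanSpace ℝ (Fin d))) (ξ : EuclideanSpace ℝ (Fin d)) : ℝ :=
  min (Metric.infDist ξ Oᶜ / (1 + √(‖ξ‖ ^ 2 - Metric.infDist ξ Oᶜ ^ 2))) (1 / (1 + ‖ξ‖))

/-- `Φ_ℓ(h) = ∫ A(ξ)^ℓ A(hᵀ ξ)^ℓ dξ`, with values in `[0, ∞]`. -/
noncomputable def auxPhi {H : Subgroup (GL (Fin d) ℝ)} (O : Set (EuclideanSpace ℝ (Fin d)))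
    (ℓ : ℕ) (h : H) : ℝ≥0∞ :=
  ∫⁻ ξ, ENNReal.ofReal (auxA O ξ ^ ℓ * auxA O (euclMap (mat h).transpose ξ) ^ ℓ)

/-- `O` is strongly `(s, w₀)`-temperately embedded with index `ℓ`: the function `Φ_ℓ` is finite
and belongs to `W^R(C⁰, L¹_m(H))`, where `m(h) = w₀(h) |det h|^{-1/2} (1 + ‖h‖_∞)^{2(s+d+1)}`. -/
def StronglyTemperatelyEmbedded {H : Subgroup (GL (Fin d) ℝ)} [MeasurableSpace H]
    (μ : Measure H) (U : Set H) (O : Set (EuclideanSpace ℝ (Fin d))) (s : ℝ) (w₀ : H → ℝ)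
    (ℓ : ℕ) : Prop :=
  (∀ h : H, auxPhi O ℓ h ≠ ∞) ∧
  MemWienerAmalgam μ U
    (fun h => w₀ h * absDet h ^ (-(1 / 2) : ℝ) * (1 + ‖euclMap (mat h)‖) ^ (2 * (s + d + 1)))
    (fun h => ((auxPhi O ℓ h).toReal : ℂ))

/-- The partial derivative `∂_{i_1} ⋯ ∂_{i_n} f (ξ)` of order `n`, where `i_j = v j`. -/
noncomputable def partialDeriv {n : ℕ} (v : Fin n → Fin d)
    (f : EuclideanSpace ℝ (Fin d) → ℂ) (ξ : EuclideanSpace ℝ (Fin d)) : ℂ :=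
  iteratedFDeriv ℝ n f ξ fun j => EuclideanSpace.single (v j) (1 : ℝ)

/-- The Schwartz norm `|f|_{r,m} = sup_{x, |α| ≤ r} (1 + |x|)^m |∂^α f(x)|`, in `[0, ∞]`, for
`f` of class `C^r`. -/
noncomputable def schwartzNorm (r m : ℕ) (f : EuclideanSpace ℝ (Fin d) → ℂ) : ℝ≥0∞ :=
  ⨆ (n : ℕ) (_ : n ≤ r) (v : Fin n → Fin d) (x : EuclideanSpace ℝ (Fin d)),
    ENNReal.ofReal ((1 + ‖x‖) ^ m) * ‖partialDeriv v f x‖ₑ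

/-- `f ∈ L¹(ℝ^d)` has vanishing moments in `Oᶜ` of order `r`: its Fourier transform, a continuous
function, is of class `C^r` (that is, its distributional derivatives of order at most `r` are
continuous functions), and its partial derivatives of order less than `r` vanish on `Oᶜ`. -/
def HasVanishingMoments (O : Set (EuclideanSpace ℝ (Fin d))) (r : ℕ)
    (f : EuclideanSpace ℝ (Fin d) → ℂ) : Prop :=
  Integrable f volume ∧ ContDiff ℝ r (𝓕 f) ∧
  ∀ n < r, ∀ v : Fin n → Fin d, ∀ ξ ∈ Oᶜ, partialDeriv v (𝓕 f) ξ = 0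

/-- The conditions on the wavelet: `ψ ∈ L¹ ∩ C^{ℓ+d+1}` has vanishing moments in `Oᶜ` of order
`t`, and `|ψ̂|_{t,t} < ∞`. -/
def WaveletCondition (O : Set (EuclideanSpace ℝ (Fin d))) (ℓ t : ℕ)
    (ψ : EuclideanSpace ℝ (Fin d) → ℂ) : Prop :=
  Integrable ψ volume ∧ ContDiff ℝ ((ℓ + d + 1 : ℕ) : ℕ∞) ψ ∧
  HasVanishingMoments O t ψ ∧ schwartzNorm t t (𝓕 ψ) < ∞

end WaveletCoorbit

/-! Decay. On the Fourier side, `W_ψ ψ (x, h)` is `|det h|^{1/2}` times the inverse Fourier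
transform at `x` of `ψ̂(ξ) · conj ψ̂(hᵀξ)`. Since `O` is invariant under nonzero scalars, `Oᶜ` is a
closed cone, and the point `z` of `Oᶜ` nearest to `ξ` satisfies `|z|² = |ξ|² - δ(ξ)²`. As `ψ̂`
vanishes to order `t` at `z`, integrating along the segment from `z` to `ξ` bounds the derivatives
of `ψ̂` of order `k ≤ t - ℓ` by a multiple of `A(ξ)^ℓ` (`exists_norm_iteratedFDeriv_le_auxA`). By
the Leibniz rule the `N`-th order derivatives of the product are dominated by `(1 + ‖h‖)^N A(ξ)^ℓ
A(hᵀξ)^ℓ`, whose integral is `(1 + ‖h‖)^N Φ_ℓ(h)`. This gives decay `(1 + |x|)^{-N}` of the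
coefficients (`exists_norm_waveletTransform_le`). Passing to the local maximum costs another `(1 +
‖h‖)^N`, because right multiplication by `(y, g)` moves `x` by `h y`. The bound then splits into a
function of `x` times a function of `h`: the first is integrable when `N > s + d`, and the second is
controlled by temperate embedding when `N ≤ s + d + 1`.

Existence. `Oᶜ` lies in the zero set of a nonzero polynomial `p(ξ) = det (X₁ξ, …, X_dξ)`, with `X_j`
in the Lie algebra of the dual group `Hᵀ` (`exists_det_ne_zero`). If that Lie algebra did not span
at a point of the open orbit, the orbit would be a countable union of smooth images of
lower-dimensional spaces. Conversely, where `p(ξ) ≠ 0` the orbit of `ξ` is a neighbourhood of `ξ`,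
so it meets the dense set `O`. For a bump function `φ`, the function with Fourier transform `p^t φ̂`
is a constant-coefficient differential operator applied to `φ`; it is compactly supported and its
transform vanishes to order `t` on `Oᶜ`. -/

namespace WaveletCoorbit
open NormedSpace Filter

/-! ### Exponentials and the Lie algebra of a closed linear group. -/

section ClosedLinearGroup

section ExpReal
variable {A : Type*} [NormedRing A] [NormedAlgebra ℝ A] [CompleteSpace A]

theorem exp_add_of_commute_real {x y : A} (h : Commute x y) : exp (x + y) = exp x * exp y := by
  have : NormedAlgebra ℚ A := NormedAlgebra.restrictScalars ℚ ℝ A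
  exact exp_add_of_commute h

theorem exp_mul_exp_neg_real (x : A) : exp x * exp (-x) = 1 := by
  rw [← exp_add_of_commute_real (Commute.refl x).neg_right, add_neg_cancel, exp_zero]

theorem exp_neg_mul_exp_real (x : A) : exp (-x) * exp x = 1 := by
  rw [← exp_add_of_commute_real (Commute.refl x).neg_left, neg_add_cancel, exp_zero]

theorem isUnit_exp_real (x : A) : IsUnit (exp x) :=
  ⟨⟨exp x, exp (-x), exp_mul_exp_neg_real x, exp_neg_mul_exp_real x⟩, rfl⟩

theorem exp_nsmul_real (n : ℕ) (x : A) : exp (n • x) = exp x ^ n := by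
  have : NormedAlgebra ℚ A := NormedAlgebra.restrictScalars ℚ ℝ A
  exact exp_nsmul n x

theorem continuous_exp_real : Continuous (exp : A → A) := by
  have : NormedAlgebra ℚ A := NormedAlgebra.restrictScalars ℚ ℝ A
  exact exp_continuous

theorem contDiff_exp_real : ContDiff ℝ 1 (exp : A → A) :=
  contDiff_iff_contDiffAt.2 fun x => (exp_analytic (𝕂 := ℝ) x).contDiffAt

theorem hasStrictFDerivAt_exp_zero_id :
    HasStrictFDerivAt (exp : A → A) (ContinuousLinearEquiv.refl ℝ A : A →L[ℝ] A) 0 :=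
  hasStrictFDerivAt_exp_zero (𝕂 := ℝ)

end ExpReal

/-- `S` is a group of invertible elements of `A`, closed in the group of units of `A`. -/
structure IsClosedLinearGroup {A : Type*} [NormedRing A] (S : Set A) : Prop where
  one_mem : (1 : A) ∈ S
  mul_mem : ∀ {a b}, a ∈ S → b ∈ S → a * b ∈ S
  inv_mem : ∀ {a}, a ∈ S → ∃ b ∈ S, a * b = 1 ∧ b * a = 1
  closed : ∀ {a}, IsUnit a → a ∈ closure S → a ∈ S

theorem IsClosedLinearGroup.mem_of_mul_eq_one {A : Type*} [NormedRing A] {S : Set A}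
    (hS : IsClosedLinearGroup S) {a b : A} (ha : a ∈ S) (h : a * b = 1) :
    b ∈ S := by
  obtain ⟨c, hc, -, h2⟩ := hS.inv_mem ha
  have : b = c := by
    calc b = (c * a) * b := by rw [h2, one_mul]
      _ = c := by rw [mul_assoc, h, mul_one]
  exact this ▸ hc

theorem IsClosedLinearGroup.pow_mem {A : Type*} [NormedRing A] {S : Set A}
    (hS : IsClosedLinearGroup S) {a : A} (h : a ∈ S) (n : ℕ) : a ^ n ∈ S := by
  induction n with
  | zero => simpa using hS.one_mem
  | succ n ih => rw [pow_succ]; exact hS.mul_mem ih h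

variable {A : Type*} [NormedRing A] [NormedAlgebra ℝ A] [CompleteSpace A] {S : Set A}

namespace IsClosedLinearGroup

theorem exp_neg_mem (hS : IsClosedLinearGroup S) {x : A} (h : exp x ∈ S) : exp (-x) ∈ S :=
  hS.mem_of_mul_eq_one h (exp_mul_exp_neg_real x)

theorem exp_zsmul_mem (hS : IsClosedLinearGroup S) {x : A} (h : exp x ∈ S) (k : ℤ) :
    exp (k • x) ∈ S := by
  obtain ⟨n, rfl | rfl⟩ := k.eq_nat_or_neg
  · rw [natCast_zsmul, exp_nsmul_real]; exact hS.pow_mem h n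
  · rw [neg_smul, natCast_zsmul]
    apply hS.exp_neg_mem
    rw [exp_nsmul_real]; exact hS.pow_mem h n

/-- If `exp (Y i) ∈ S` with `Y i → 0` and `c i • Y i → X` then `exp X ∈ S`. -/
theorem exp_mem_of_tendsto (hS : IsClosedLinearGroup S) {ι : Type*} {l : Filter ι} [l.NeBot]
    {Y : ι → A} {c : ι → ℝ} {X : A} (hY : Tendsto Y l (𝓝 0)) (hm : ∀ᶠ i in l, exp (Y i) ∈ S)
    (hc : Tendsto (fun i => c i • Y i) l (𝓝 X)) : exp X ∈ S := by
  apply hS.closed (isUnit_exp_real X)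
  -- Replacing `c i` by its integer part changes `c i • Y i` by at most `‖Y i‖`, and the exponential
  -- of an integer multiple of `Y i` is a power of `exp (Y i)`, hence in `S`.
  have h0 : Tendsto (fun i => (Int.fract (c i)) • Y i) l (𝓝 0) := by
    refine squeeze_zero_norm (fun i => ?_) (tendsto_zero_iff_norm_tendsto_zero.1 hY)
    rw [norm_smul, Real.norm_of_nonneg (Int.fract_nonneg _)]
    exact mul_le_of_le_one_left (norm_nonneg _) (Int.fract_lt_one _).le
  have h1 : Tendsto (fun i => ⌊c i⌋ • Y i) l (𝓝 X) := by
    have := hc.sub h0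
    rw [sub_zero] at this
    refine this.congr fun i => ?_
    rw [← sub_smul, Int.self_sub_fract, Int.cast_smul_eq_zsmul]
  refine mem_closure_of_tendsto ((continuous_exp_real.tendsto X).comp h1) ?_
  filter_upwards [hm] with i hi using hS.exp_zsmul_mem hi _

/-- With `L` a local logarithm at `1`, `L (exp (rX) exp (rY)) = r (X + Y) + o(r)`. Rescaling by
`r⁻¹` and letting `r → 0` reduces the claim to `exp_mem_of_tendsto`. This is what makes `lieAlg`
closed under addition. -/
theorem exp_add_mem (hS : IsClosedLinearGroup S) {X Y : A} (hX : ∀ t : ℝ, exp (t • X) ∈ S)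
    (hY : ∀ t : ℝ, exp (t • Y) ∈ S) : exp (X + Y) ∈ S := by
  have hexp := hasStrictFDerivAt_exp_zero_id (A := A)
  set L := HasStrictFDerivAt.localInverse _ _ _ hexp with hL
  have hL' : HasFDerivAt L (ContinuousLinearMap.id ℝ A) 1 := by
    have := hexp.to_localInverse.hasFDerivAt
    rw [exp_zero] at this
    exact this
  have hLr : ∀ᶠ y in 𝓝 (1 : A), exp (L y) = y := by
    have := hexp.eventually_right_inverse
    rwa [exp_zero] at this
  have hL1 : L 1 = 0 := by
    have := hexp.eventually_left_inverse.self_of_nhds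
    rwa [exp_zero] at this
  have hder (Z : A) : HasDerivAt (fun r : ℝ => exp (r • Z)) Z 0 := by
    have h1 : HasFDerivAt (exp : A → A) (ContinuousLinearMap.id ℝ A) ((0 : ℝ) • Z) := by
      rw [zero_smul]; exact hexp.hasFDerivAt
    have h2 : HasDerivAt (fun r : ℝ => r • Z) Z 0 := by
      simpa using (hasDerivAt_id (0 : ℝ)).smul_const Z
    exact h1.comp_hasDerivAt (0 : ℝ) h2
  have hprod : HasDerivAt (fun r : ℝ => exp (r • X) * exp (r • Y)) (X + Y) 0 := by
    have := (hder X).mul (hder Y)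
    simp only [zero_smul, exp_zero, mul_one, one_mul] at this
    exact this
  set g : ℝ → A := fun r => L (exp (r • X) * exp (r • Y)) with hg
  have hg0 : g 0 = 0 := by simp [hg, hL1]
  have hgd : HasDerivAt g (X + Y) 0 := by
    have h1 : HasFDerivAt L (ContinuousLinearMap.id ℝ A)
        (exp ((0 : ℝ) • X) * exp ((0 : ℝ) • Y)) := by simpa using hL'
    exact h1.comp_hasDerivAt (0 : ℝ) hprod
  have hgc : Tendsto g (𝓝[≠] 0) (𝓝 0) := by
    have := hgd.continuousAt.tendsto
    rw [hg0] at this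
    exact this.mono_left nhdsWithin_le_nhds
  refine hS.exp_mem_of_tendsto (c := fun r : ℝ => r⁻¹) hgc ?_ ?_
  · have hc : Tendsto (fun r : ℝ => exp (r • X) * exp (r • Y)) (𝓝[≠] 0) (𝓝 1) := by
      have := hprod.continuousAt.tendsto
      simp only [zero_smul, exp_zero, mul_one] at this
      exact this.mono_left nhdsWithin_le_nhds
    filter_upwards [hc.eventually hLr] with r hr
    rw [hg]
    simp only [hr]
    exact hS.mul_mem (hX r) (hY r)
  · have := hasDerivAt_iff_tendsto_slope.1 hgd
    refine this.congr fun r => ?_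
    simp [slope, hg0]

/-- The Lie algebra of a closed linear group. -/
def lieAlg (hS : IsClosedLinearGroup S) : Submodule ℝ A where
  carrier := {X | ∀ t : ℝ, exp (t • X) ∈ S}
  zero_mem' t := by simpa using hS.one_mem
  add_mem' {X Y} hX hY t := by
    rw [smul_add]
    refine hS.exp_add_mem (fun r => ?_) (fun r => ?_)
    · rw [smul_smul]; exact hX _
    · rw [smul_smul]; exact hY _
  smul_mem' c X hX t := by rw [smul_smul]; exact hX _

theorem exp_mem (hS : IsClosedLinearGroup S) {X : A} (hX : X ∈ hS.lieAlg) : exp X ∈ S := by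
  simpa using hX 1

/-- Near `0`, a complement of the Lie algebra contains no nonzero logarithms of elements
of the group. -/
theorem eventually_eq_zero_of_disjoint [FiniteDimensional ℝ A] (hS : IsClosedLinearGroup S)
    {M : Submodule ℝ A} (hM : Disjoint M hS.lieAlg) :
    ∀ᶠ W in 𝓝 (0 : A), W ∈ M → exp W ∈ S → W = 0 := by
  by_contra hcon
  set T : Set A := {W | W ∈ M ∧ exp W ∈ S ∧ W ≠ 0} with hT
  have hne : (𝓝 (0 : A) ⊓ 𝓟 T).NeBot := by
    rw [← frequently_mem_iff_neBot]
    refine (Filter.not_eventually.1 hcon).mono fun W hW => ?_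
    push Not at hW
    exact hW
  set u := Ultrafilter.of (𝓝 (0 : A) ⊓ 𝓟 T) with hu
  have hu1 : (u : Filter A) ≤ 𝓝 0 := (Ultrafilter.of_le _).trans inf_le_left
  have hu2 : ∀ᶠ W in (u : Filter A), W ∈ T :=
    le_principal_iff.1 ((Ultrafilter.of_le _).trans inf_le_right)
  -- The normalised logarithms converge along the ultrafilter to a unit vector `X`. It lies in `M`,
  -- which is closed, and in the Lie algebra by `exp_mem_of_tendsto`, contradicting disjointness.
  have hsph : ∀ᶠ W in (u : Filter A), ‖W‖⁻¹ • W ∈ Metric.sphere (0 : A) 1 := by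
    filter_upwards [hu2] with W hW
    simp [norm_smul, inv_mul_cancel₀ (norm_ne_zero_iff.2 hW.2.2)]
  have : ProperSpace A := FiniteDimensional.proper ℝ A
  obtain ⟨X, hX, hXl⟩ := (isCompact_sphere (0 : A) 1).ultrafilter_le_nhds'
    (u.map fun W => ‖W‖⁻¹ • W) hsph
  have hlim : Tendsto (fun W : A => ‖W‖⁻¹ • W) (u : Filter A) (𝓝 X) := hXl
  have hXM : X ∈ M := by
    have hcl : IsClosed (M : Set A) := M.closed_of_finiteDimensional
    refine hcl.mem_of_tendsto hlim ?_
    filter_upwards [hu2] with W hW using M.smul_mem _ hW.1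
  have hXh : X ∈ hS.lieAlg := by
    intro t
    refine hS.exp_mem_of_tendsto (l := (u : Filter A)) (Y := fun W => W)
      (c := fun W => t * ‖W‖⁻¹) hu1 ?_ ?_
    · filter_upwards [hu2] with W hW using hW.2.1
    · simpa [mul_smul] using hlim.const_smul t
  have hX0 : X = 0 := by
    have := hM.le_bot ⟨hXM, hXh⟩
    simpa using this
  simp [hX0] at hX

/-- Near `1`, every element of the group is a product of exponentials from two subspaces spanning
the Lie algebra. -/
theorem eventually_exists_exp_mul_exp [FiniteDimensional ℝ A] (hS : IsClosedLinearGroup S)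
    {m k : Submodule ℝ A} (hsup : m ⊔ k = hS.lieAlg) :
    ∀ᶠ a in 𝓝 (1 : A), a ∈ S → ∃ Y ∈ m, ∃ X ∈ k, a = exp Y * exp X := by
  obtain ⟨M, hM⟩ := hS.lieAlg.exists_isCompl
  have hmkl : m ≤ hS.lieAlg := hsup ▸ le_sup_left
  have hkl : k ≤ hS.lieAlg := hsup ▸ le_sup_right
  -- The derivative of `F` at `0` is addition, which is onto, so `F` sends neighbourhoods of `0` to
  -- neighbourhoods of `1`. For a value in `S` with small arguments, the factor from the complement
  -- `M` also lies in `S`, hence is trivial.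
  let F : M × m × k → A := fun p => exp (p.1 : A) * (exp (p.2.1 : A) * exp (p.2.2 : A))
  let F' : M × m × k →L[ℝ] A :=
    M.subtypeL.comp (ContinuousLinearMap.fst ℝ M (m × k)) +
    (m.subtypeL.comp ((ContinuousLinearMap.fst ℝ m k).comp (ContinuousLinearMap.snd ℝ M (m × k))) +
     k.subtypeL.comp ((ContinuousLinearMap.snd ℝ m k).comp (ContinuousLinearMap.snd ℝ M (m × k))))
  have hexp : ∀ (L : M × m × k →L[ℝ] A), HasStrictFDerivAt (fun p => exp (L p)) L 0 := by
    intro L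
    have h1 : HasStrictFDerivAt (exp : A → A) (ContinuousLinearMap.id ℝ A) (L 0) := by
      rw [map_zero]; exact hasStrictFDerivAt_exp_zero_id
    exact h1.comp (0 : M × m × k) L.hasStrictFDerivAt
  have hF : HasStrictFDerivAt F F' 0 := by
    have h1 := hexp (M.subtypeL.comp (ContinuousLinearMap.fst ℝ M (m × k)))
    have h2 := hexp (m.subtypeL.comp
      ((ContinuousLinearMap.fst ℝ m k).comp (ContinuousLinearMap.snd ℝ M (m × k))))
    have h3 := hexp (k.subtypeL.comp
      ((ContinuousLinearMap.snd ℝ m k).comp (ContinuousLinearMap.snd ℝ M (m × k))))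
    have h := h1.mul' (h2.mul' h3)
    refine h.congr_fderiv ?_
    ext p <;> simp [F']
  have hsurj : F'.range = ⊤ := by
    rw [LinearMap.range_eq_top]
    intro a
    have ha : a ∈ hS.lieAlg ⊔ M := by rw [hM.sup_eq_top]; trivial
    obtain ⟨b, hb, z, hz, rfl⟩ := Submodule.mem_sup.1 ha
    rw [← hsup] at hb
    obtain ⟨y, hy, x, hx, rfl⟩ := Submodule.mem_sup.1 hb
    exact ⟨(⟨z, hz⟩, ⟨y, hy⟩, ⟨x, hx⟩), by simp [F', add_comm]⟩
  have hmap := hF.map_nhds_eq_of_surj hsurj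
  have hF0 : F 0 = 1 := by simp [F]
  rw [hF0] at hmap
  have hev : ∀ᶠ p : M × m × k in 𝓝 0, (p.1 : A) ∈ M → exp (p.1 : A) ∈ S → (p.1 : A) = 0 := by
    have hc : Tendsto (fun p : M × m × k => (p.1 : A)) (𝓝 0) (𝓝 0) := by
      have : Continuous fun p : M × m × k => (p.1 : A) := by fun_prop
      simpa using this.tendsto 0
    exact hc.eventually (hS.eventually_eq_zero_of_disjoint hM.symm.disjoint)
  have := Filter.image_mem_map (m := F) hev
  rw [hmap] at this
  filter_upwards [this]
  rintro a ⟨⟨Z, Y, X⟩, hp, rfl⟩ haS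
  have hYX : exp (Y : A) * exp (X : A) ∈ S :=
    hS.mul_mem (hS.exp_mem (hmkl Y.2)) (hS.exp_mem (hkl X.2))
  obtain ⟨b, hb, hb1, -⟩ := hS.inv_mem hYX
  have hZ : (Z : A) = 0 := by
    refine hp Z.2 ?_
    have : exp (Z : A) = F (Z, Y, X) * b := by
      simp only [F]
      rw [mul_assoc (exp (Z : A)), hb1, mul_one]
    rw [this]
    exact hS.mul_mem haS hb
  exact ⟨Y, Y.2, X, X.2, by simp [F, hZ]⟩

end IsClosedLinearGroup
end ClosedLinearGroup

/-! ### Open orbits and spanning by the Lie algebra. -/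

section OpenOrbit
variable {E : Type*} [NormedAddCommGroup E] [NormedSpace ℝ E] [FiniteDimensional ℝ E]
  {S : Set (E →L[ℝ] E)}

theorem exp_apply_eq_self {X : E →L[ℝ] E} {x : E} (h : X x = 0) : exp X x = x := by
  have : CompleteSpace E := FiniteDimensional.complete ℝ E
  have h1 := (exp_series_hasSum_exp' (𝕂 := ℝ) X).mapL (ContinuousLinearMap.apply ℝ E x)
  have h2 : HasSum (fun n : ℕ => ContinuousLinearMap.apply ℝ E x
      (((n.factorial : ℝ))⁻¹ • X ^ n)) x := by
    convert hasSum_single (f := fun n : ℕ => ContinuousLinearMap.apply ℝ E x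
      (((n.factorial : ℝ))⁻¹ • X ^ n)) 0 ?_ using 1
    · simp
    · intro n hn
      obtain ⟨n, rfl⟩ := Nat.exists_eq_succ_of_ne_zero hn
      simp [pow_succ, h]
  exact h1.unique h2

/-- If the orbit of `x` has nonempty interior then the Lie algebra spans everything at `x`. -/
theorem IsClosedLinearGroup.lieAlg_map_eq_top (hS : IsClosedLinearGroup S) {x : E}
    (hx : (interior {y | ∃ a ∈ S, y = a x}).Nonempty) :
    hS.lieAlg.map (ContinuousLinearMap.apply ℝ E x : (E →L[ℝ] E) →L[ℝ] E).toLinearMap = ⊤ := by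
  have : CompleteSpace E := FiniteDimensional.complete ℝ E
  by_contra hne
  set ev : (E →L[ℝ] E) →ₗ[ℝ] E :=
    (ContinuousLinearMap.apply ℝ E x : (E →L[ℝ] E) →L[ℝ] E).toLinearMap with hev
  -- `k` is the Lie algebra of the stabiliser of `x`, and `m` a complement of it in `lieAlg`.
  -- Evaluation at `x` is injective on `m` with image in a proper subspace, whence `dim m < dim E`.
  set k := hS.lieAlg ⊓ ev.ker with hk
  obtain ⟨m', hm'⟩ := k.exists_isCompl
  set m := m' ⊓ hS.lieAlg with hm
  have hsup : m ⊔ k = hS.lieAlg := by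
    rw [hm, inf_comm, inf_sup_assoc_of_le]
    · rw [sup_comm, hm'.sup_eq_top, inf_top_eq]
    · exact inf_le_left
  have hdisj : Disjoint m k := hm'.symm.disjoint.mono_left inf_le_left
  have hdim : Module.finrank ℝ m < Module.finrank ℝ E := by
    have h1 : Function.Injective (ev.domRestrict m) := by
      rw [← LinearMap.ker_eq_bot, LinearMap.ker_eq_bot']
      rintro ⟨y, hy⟩ h0
      have : y ∈ m ⊓ k := ⟨hy, hy.2, h0⟩
      rw [hdisj.eq_bot] at this
      simpa using this
    have h2 : Module.finrank ℝ m = Module.finrank ℝ (ev.domRestrict m).range :=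
      (LinearMap.finrank_range_of_inj h1).symm
    rw [h2]
    refine lt_of_le_of_lt (Submodule.finrank_mono ?_) (Submodule.finrank_lt hne)
    rintro _ ⟨⟨y, hy⟩, rfl⟩
    exact ⟨y, hy.2, rfl⟩
  have hnear := hS.eventually_exists_exp_mul_exp hsup
  -- translates of the exponential chart
  have hcov : ∀ a ∈ S, {b | b ∈ S → ∃ Y : m, b x = a (exp (Y : E →L[ℝ] E) x)} ∈ 𝓝[S] a := by
    intro a ha
    obtain ⟨c, hc, hac, hca⟩ := hS.inv_mem ha
    have ht : Tendsto (fun b => c * b) (𝓝 a) (𝓝 1) := by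
      have : Continuous fun b : E →L[ℝ] E => c * b := continuous_const.mul continuous_id
      rw [← hca]; exact this.tendsto a
    refine nhdsWithin_le_nhds ?_
    filter_upwards [ht.eventually hnear] with b hb hbS
    obtain ⟨Y, hY, X, hX, h⟩ := hb (hS.mul_mem hc hbS)
    refine ⟨⟨Y, hY⟩, ?_⟩
    have hb' : b = a * (exp Y * exp X) := by rw [← h, ← mul_assoc, hac, one_mul]
    rw [hb']
    have hXx : X x = 0 := hX.2
    simp [exp_apply_eq_self hXx]
  -- By second countability, countably many charts cover `S`. The orbit is then a countable union of
  -- `C¹` images of `m`, so its Hausdorff dimension is below `dim E` and it has empty interior.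
  have : SecondCountableTopology (E →L[ℝ] E) := by
    have : ProperSpace (E →L[ℝ] E) := FiniteDimensional.proper ℝ _
    infer_instance
  obtain ⟨T, hTS, hT, hTc⟩ := TopologicalSpace.countable_cover_nhdsWithin hcov
  have hsub : {y | ∃ a ∈ S, y = a x} ⊆
      ⋃ a ∈ T, Set.range fun Y : m => a (exp (Y : E →L[ℝ] E) x) := by
    rintro y ⟨b, hb, rfl⟩
    obtain ⟨a, ha, hab⟩ := Set.mem_iUnion₂.1 (hTc hb)
    obtain ⟨Y, hY⟩ := hab hb
    exact Set.mem_iUnion₂.2 ⟨a, ha, Y, hY.symm⟩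
  have hdimH : dimH {y | ∃ a ∈ S, y = a x} < Module.finrank ℝ E := by
    refine lt_of_le_of_lt ((dimH_mono hsub).trans ?_) (Nat.cast_lt.2 hdim)
    rw [dimH_bUnion hT]
    refine iSup₂_le fun a _ => ContDiff.dimH_range_le ?_
    refine a.contDiff.comp ?_
    refine (ContinuousLinearMap.apply ℝ E x : (E →L[ℝ] E) →L[ℝ] E).contDiff.comp ?_
    exact contDiff_exp_real.comp m.subtypeL.contDiff
  have hd := dense_compl_of_dimH_lt_finrank hdimH
  rw [← interior_eq_empty_iff_dense_compl] at hd
  exact hx.ne_empty hd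

/-- If the Lie algebra spans everything at `x` then the orbit of `x` is a neighbourhood of `x`. -/
theorem IsClosedLinearGroup.orbit_mem_nhds (hS : IsClosedLinearGroup S) {x : E}
    (L : E →ₗ[ℝ] (E →L[ℝ] E)) (hL : ∀ y, L y ∈ hS.lieAlg)
    (hx : Function.Surjective fun y => L y x) :
    {y | ∃ a ∈ S, y = a x} ∈ 𝓝 x := by
  have : CompleteSpace E := FiniteDimensional.complete ℝ E
  let Lc : E →L[ℝ] (E →L[ℝ] E) := LinearMap.toContinuousLinearMap L
  have h1 : HasStrictFDerivAt (exp : (E →L[ℝ] E) → _) (ContinuousLinearMap.id ℝ (E →L[ℝ] E))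
      (Lc 0) := by
    rw [map_zero]; exact hasStrictFDerivAt_exp_zero_id
  -- The derivative at `0` of `y ↦ exp (L y) x` is `y ↦ L y x`, which is onto, so the map is open at
  -- `0`.
  have h2 := (ContinuousLinearMap.apply ℝ E x : (E →L[ℝ] E) →L[ℝ] E).hasStrictFDerivAt.comp
    (0 : E) (h1.comp (0 : E) Lc.hasStrictFDerivAt)
  have h3 := h2.map_nhds_eq_of_surj (by
    rw [LinearMap.range_eq_top]
    intro z
    obtain ⟨y, hy⟩ := hx z
    exact ⟨y, hy⟩)
  simp only [map_zero, exp_zero] at h3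
  have h4 : (ContinuousLinearMap.apply ℝ E x) (1 : E →L[ℝ] E) = x := rfl
  rw [h4] at h3
  rw [← h3]
  refine Filter.mem_map.2 (Filter.Eventually.of_forall fun y => ?_)
  exact ⟨exp (L y), hS.exp_mem (hL y), rfl⟩

end OpenOrbit
end WaveletCoorbit

/-! ### The dual action and the complement of its open orbit. -/

namespace WaveletCoorbit
open NormedSpace Filter
variable {d : ℕ}

/-- The group of dual dilations `hᵀ` for `h ∈ H`. -/
def dualSet (H : Subgroup (GL (Fin d) ℝ)) :
    Set (EuclideanSpace ℝ (Fin d) →L[ℝ] EuclideanSpace ℝ (Fin d)) :=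
  {a | ∃ h : H, a = euclMap (mat h).transpose}

theorem euclMap_mul (M N : Matrix (Fin d) (Fin d) ℝ) : euclMap (M * N) = euclMap M * euclMap N := by
  simp [euclMap]

theorem euclMap_one : euclMap (1 : Matrix (Fin d) (Fin d) ℝ) = 1 := by simp [euclMap]

theorem mat_mul {H : Subgroup (GL (Fin d) ℝ)} (g h : H) : mat (g * h) = mat g * mat h := by
  simp [mat]

theorem mat_one {H : Subgroup (GL (Fin d) ℝ)} : mat (1 : H) = 1 := by simp [mat]

theorem mat_mul_inv {H : Subgroup (GL (Fin d) ℝ)} (h : H) : mat h * mat h⁻¹ = 1 := by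
  rw [← mat_mul, mul_inv_cancel, mat_one]

theorem mat_inv_mul {H : Subgroup (GL (Fin d) ℝ)} (h : H) : mat h⁻¹ * mat h = 1 := by
  rw [← mat_mul, inv_mul_cancel, mat_one]

theorem transpose_mul_inv {H : Subgroup (GL (Fin d) ℝ)} (h : H) :
    euclMap (mat h).transpose * euclMap (mat h⁻¹).transpose = 1 := by
  rw [← euclMap_mul, ← Matrix.transpose_mul, mat_inv_mul, Matrix.transpose_one, euclMap_one]

theorem transpose_inv_mul {H : Subgroup (GL (Fin d) ℝ)} (h : H) :
    euclMap (mat h⁻¹).transpose * euclMap (mat h).transpose = 1 := by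
  rw [← euclMap_mul, ← Matrix.transpose_mul, mat_mul_inv, Matrix.transpose_one, euclMap_one]

theorem continuous_euclMap : Continuous (euclMap : Matrix (Fin d) (Fin d) ℝ → _) := by
  have : Continuous (Matrix.toEuclideanCLM (n := Fin d) (𝕜 := ℝ)).toAlgEquiv.toLinearMap :=
    LinearMap.continuous_of_finiteDimensional _
  exact this

theorem euclMap_transpose (M : Matrix (Fin d) (Fin d) ℝ) :
    euclMap M.transpose = star (euclMap M) := by
  rw [euclMap, euclMap, ← map_star, Matrix.star_eq_conjTranspose,
    Matrix.conjTranspose_eq_transpose_of_trivial]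

theorem euclMap_injective : Function.Injective (euclMap : Matrix (Fin d) (Fin d) ℝ → _) :=
  (Matrix.toEuclideanCLM (n := Fin d) (𝕜 := ℝ)).injective

theorem continuous_mat {H : Subgroup (GL (Fin d) ℝ)} : Continuous (mat : H → _) :=
  Units.continuous_val.comp continuous_subtype_val

theorem isClosedLinearGroup_dualSet {H : Subgroup (GL (Fin d) ℝ)}
    (hH : IsClosed (H : Set (GL (Fin d) ℝ))) : IsClosedLinearGroup (dualSet H) where
  one_mem := ⟨1, by rw [mat_one, Matrix.transpose_one, euclMap_one]⟩
  mul_mem := by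
    rintro _ _ ⟨g, rfl⟩ ⟨h, rfl⟩
    exact ⟨h * g, by rw [mat_mul, Matrix.transpose_mul, euclMap_mul]⟩
  inv_mem := by
    rintro _ ⟨h, rfl⟩
    exact ⟨_, ⟨h⁻¹, rfl⟩, transpose_mul_inv h, transpose_inv_mul h⟩
  closed := by
    intro a ha hcl
    let e := Matrix.toEuclideanCLM (n := Fin d) (𝕜 := ℝ)
    have hec : Continuous e.symm := by
      have : Continuous e.symm.toAlgEquiv.toLinearMap := LinearMap.continuous_of_finiteDimensional _
      exact this
    obtain ⟨u, rfl⟩ := ha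
    let E := EuclideanSpace ℝ (Fin d)
    let f : (E →L[ℝ] E) →* Matrix (Fin d) (Fin d) ℝ := e.symm.toAlgEquiv.toAlgHom
    let φ : (E →L[ℝ] E)ˣ → GL (Fin d) ℝ := fun v => Units.map f (star v)
    have hφ : Continuous φ := by
      have hs : Continuous (star : (E →L[ℝ] E) → (E →L[ℝ] E)) :=
        (ContinuousLinearMap.adjoint (𝕜 := ℝ) (E := E) (F := E)).continuous
      refine (Continuous.units_map f hec).comp (Units.continuous_iff.2 ⟨?_, ?_⟩)
      · exact hs.comp Units.continuous_val
      · exact hs.comp (Units.continuous_val.comp continuous_inv)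
    have hval (v : (E →L[ℝ] E)ˣ) : euclMap (φ v : Matrix (Fin d) (Fin d) ℝ).transpose = v := by
      rw [euclMap_transpose]
      have : euclMap (φ v : Matrix (Fin d) (Fin d) ℝ) = star (v : E →L[ℝ] E) :=
        e.apply_symm_apply _
      rw [this, star_star]
    have hS : dualSet H = Units.val '' (φ ⁻¹' (H : Set (GL (Fin d) ℝ))) := by
      ext b
      constructor
      · rintro ⟨h, rfl⟩
        let v : (E →L[ℝ] E)ˣ := ⟨_, _, transpose_mul_inv h, transpose_inv_mul h⟩
        refine ⟨v, ?_, rfl⟩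
        have : φ v = h := by
          apply Units.ext
          apply Matrix.transpose_injective
          apply euclMap_injective
          rw [hval]
          rfl
        rw [Set.mem_preimage, this]
        exact h.2
      · rintro ⟨v, hv, rfl⟩
        exact ⟨⟨φ v, hv⟩, (hval v).symm⟩
    -- Units embed topologically into the algebra, so a unit in the closure of the image is already
    -- in the closure taken among units, where `H` is closed.
    have hu : u ∈ closure (φ ⁻¹' (H : Set (GL (Fin d) ℝ))) := by
      rw [Units.isOpenEmbedding_val.isEmbedding.closure_eq_preimage_closure_image, ← hS]
      exact hcl
    rw [(hH.preimage hφ).closure_eq] at hu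
    exact ⟨⟨φ u, hu⟩, (hval u).symm⟩

variable {H : Subgroup (GL (Fin d) ℝ)} {O : Set (EuclideanSpace ℝ (Fin d))}

theorem euclMap_transpose_mul_apply (g h : H) (ξ : EuclideanSpace ℝ (Fin d)) :
    euclMap (mat (g * h)).transpose ξ
      = euclMap (mat h).transpose (euclMap (mat g).transpose ξ) := by
  rw [mat_mul, Matrix.transpose_mul, euclMap_mul]; rfl

theorem euclMap_transpose_inv_apply (h : H) (ξ : EuclideanSpace ℝ (Fin d)) :
    euclMap (mat h⁻¹).transpose (euclMap (mat h).transpose ξ) = ξ := by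
  rw [← euclMap_transpose_mul_apply, mul_inv_cancel, mat_one, Matrix.transpose_one, euclMap_one]; rfl

namespace IsOpenDualOrbit

theorem dense (hO : IsOpenDualOrbit H O) : Dense O := by
  have := hO.2.2
  have h := interior_eq_empty_iff_dense_compl.1 (Measure.interior_eq_empty_of_null this)
  rwa [compl_compl] at h

theorem mem_of_map_mem (hO : IsOpenDualOrbit H O) (h : H) {ξ : EuclideanSpace ℝ (Fin d)}
    (hξ : euclMap (mat h).transpose ξ ∈ O) : ξ ∈ O := by
  obtain ⟨ξ₀, rfl⟩ := hO.1
  obtain ⟨g, hg⟩ := hξ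
  refine ⟨g * h⁻¹, ?_⟩
  rw [euclMap_transpose_mul_apply, ← hg, euclMap_transpose_inv_apply]

theorem map_mem (hO : IsOpenDualOrbit H O) (h : H) {ξ : EuclideanSpace ℝ (Fin d)}
    (hξ : ξ ∈ O) : euclMap (mat h).transpose ξ ∈ O := by
  apply hO.mem_of_map_mem h⁻¹
  rwa [euclMap_transpose_inv_apply]

/-- A point of the orbit generates the orbit. -/
theorem exists_map_eq (hO : IsOpenDualOrbit H O) {ξ η : EuclideanSpace ℝ (Fin d)} (hξ : ξ ∈ O)
    (hη : η ∈ O) : ∃ h : H, η = euclMap (mat h).transpose ξ := by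
  obtain ⟨ξ₀, rfl⟩ := hO.1
  obtain ⟨g, rfl⟩ := hξ
  obtain ⟨k, rfl⟩ := hη
  exact ⟨g⁻¹ * k, by rw [euclMap_transpose_mul_apply, euclMap_transpose_inv_apply]⟩

/-- Scalars commute with the action: as `O` is dense and `c O` is open, some `η ∈ O` has `c⁻¹ η ∈
O`. Moving `c⁻¹ η` to `ξ` by a group element moves `η` to `c ξ`. -/
theorem smul_mem (hO : IsOpenDualOrbit H O) {c : ℝ} (hc : c ≠ 0) {ξ : EuclideanSpace ℝ (Fin d)}
    (hξ : ξ ∈ O) : c • ξ ∈ O := by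
  have hop : IsOpen ((fun η => c⁻¹ • η) ⁻¹' O) := hO.2.1.preimage (continuous_const_smul _)
  obtain ⟨η, hη2, hη1⟩ := hO.dense.inter_open_nonempty _ hop ⟨c • ξ, by simpa [hc] using hξ⟩
  obtain ⟨h, rfl⟩ := hO.exists_map_eq hη2 hξ
  rw [← map_smul, smul_inv_smul₀ hc]
  exact hO.map_mem h hη1

theorem zero_notMem (hd : 0 < d) (hO : IsOpenDualOrbit H O) : (0 : EuclideanSpace ℝ (Fin d)) ∉ O := by
  intro h0
  have : O ⊆ {0} := by
    intro η hη
    obtain ⟨h, rfl⟩ := hO.exists_map_eq h0 hη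
    simp
  have hO' : O = {0} := this.antisymm (by simpa using h0)
  have : Nontrivial (EuclideanSpace ℝ (Fin d)) := by
    have : Nonempty (Fin d) := ⟨⟨0, hd⟩⟩
    infer_instance
  have := hO.2.1
  rw [hO'] at this
  exact not_isOpen_singleton (0 : EuclideanSpace ℝ (Fin d)) this

/-- The complement of the open dual orbit lies in the zero set of the determinant of a matrix of
linear forms which does not vanish on all of the orbit. -/
theorem exists_det_ne_zero (hH : IsClosed (H : Set (GL (Fin d) ℝ)))
    (hO : IsOpenDualOrbit H O) :
    ∃ X : Fin d → EuclideanSpace ℝ (Fin d) →L[ℝ] EuclideanSpace ℝ (Fin d),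
      (∃ ξ, (Matrix.of fun i j => X j ξ i).det ≠ 0) ∧
      ∀ ξ ∈ Oᶜ, (Matrix.of fun i j => X j ξ i).det = 0 := by
  have hS := isClosedLinearGroup_dualSet hH
  obtain ⟨ξ₀, hOξ⟩ := hO.1
  have horb (ξ) : {ξ' | ∃ h : H, ξ' = euclMap (mat h).transpose ξ} = {y | ∃ a ∈ dualSet H, y = a ξ} := by
    ext y
    constructor
    · rintro ⟨h, rfl⟩; exact ⟨_, ⟨h, rfl⟩, rfl⟩
    · rintro ⟨_, ⟨h, rfl⟩, rfl⟩; exact ⟨h, rfl⟩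
  have hne : O.Nonempty := hO.dense.nonempty
  have htop := hS.lieAlg_map_eq_top (x := ξ₀) (by
    rw [← horb, ← hOξ, hO.2.1.interior_eq]; exact hne)
  let b := EuclideanSpace.basisFun (Fin d) ℝ
  -- This choice makes the matrix with columns `X j ξ` the identity at `ξ₀`.
  have hX : ∀ j, ∃ X ∈ hS.lieAlg, X ξ₀ = b j := by
    intro j
    have : b j ∈ hS.lieAlg.map (ContinuousLinearMap.apply ℝ _ ξ₀ :
      (EuclideanSpace ℝ (Fin d) →L[ℝ] EuclideanSpace ℝ (Fin d)) →L[ℝ] _).toLinearMap := by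
      rw [htop]; trivial
    obtain ⟨X, hX, h⟩ := this
    exact ⟨X, hX, h⟩
  choose X hXm hXb using hX
  refine ⟨X, ⟨ξ₀, ?_⟩, ?_⟩
  · have : (Matrix.of fun i j => X j ξ₀ i) = 1 := by
      ext i j
      simp [hXb, b, Matrix.one_apply]
    rw [this, Matrix.det_one]; exact one_ne_zero
  · intro ξ hξ
    by_contra hdet
    apply hξ
    -- A nonzero determinant makes `y ↦ (∑ j, y j • X j) ξ` onto, so the orbit of `ξ` is a
    -- neighbourhood of `ξ` and meets the dense set `O`; hence `ξ ∈ O`.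
    let L : EuclideanSpace ℝ (Fin d) →ₗ[ℝ]
        (EuclideanSpace ℝ (Fin d) →L[ℝ] EuclideanSpace ℝ (Fin d)) := b.toBasis.constr ℝ X
    have hL (y) : L y = ∑ j, y j • X j := by
      rw [Module.Basis.constr_apply_fintype]
      simp [b]
    have hmem := hS.orbit_mem_nhds (x := ξ) L (fun y => by
      rw [hL]; exact Submodule.sum_mem _ fun j _ => Submodule.smul_mem _ _ (hXm j)) (by
      intro z
      have hu : IsUnit (Matrix.of fun i j => X j ξ i) := by
        rw [Matrix.isUnit_iff_isUnit_det]; exact isUnit_iff_ne_zero.2 hdet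
      obtain ⟨y, hy⟩ := (Matrix.mulVec_surjective_iff_isUnit.2 hu) z.ofLp
      refine ⟨WithLp.toLp 2 y, ?_⟩
      ext i
      have := congrFun hy i
      simp only [Matrix.mulVec, dotProduct, Matrix.of_apply] at this
      rw [← this]
      simp [hL, mul_comm])
    rw [← horb] at hmem
    obtain ⟨η, hη1, h, rfl⟩ := hO.dense.inter_nhds_nonempty hmem
    exact hO.mem_of_map_mem h hη1

end IsOpenDualOrbit
end WaveletCoorbit

/-! ### Polynomial symbols and compactly supported wavelets. -/

namespace WaveletCoorbit
open Filter
open scoped SchwartzMap LineDeriv ContDiff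
section FourierSymbol
variable {E : Type*} [NormedAddCommGroup E] [InnerProductSpace ℝ E] [FiniteDimensional ℝ E]
  [MeasurableSpace E] [BorelSpace E]

/-- `q` is the symbol of a differential operator with constant coefficients, in the sense that
multiplication by `q` on the Fourier side preserves compact support. -/
def IsFourierSymbol (q : E → ℂ) : Prop :=
  ∀ φ : 𝓢(E, ℂ), HasCompactSupport φ → ∃ φ' : 𝓢(E, ℂ), HasCompactSupport φ' ∧
    ∀ ξ, (𝓕 φ') ξ = q ξ * (𝓕 φ) ξ

namespace IsFourierSymbol
variable {p q : E → ℂ}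

theorem const (c : ℂ) : IsFourierSymbol (fun _ : E => c) := fun φ hφ =>
  ⟨c • φ, hφ.mono fun x hx h => hx (by simp [h]), fun ξ => by simp [FourierTransform.fourier_smul]⟩

theorem add (hp : IsFourierSymbol p) (hq : IsFourierSymbol q) :
    IsFourierSymbol fun ξ => p ξ + q ξ := fun φ hφ => by
  obtain ⟨φ₁, h₁, e₁⟩ := hp φ hφ
  obtain ⟨φ₂, h₂, e₂⟩ := hq φ hφ
  exact ⟨φ₁ + φ₂, h₁.add h₂, fun ξ => by simp [FourierTransform.fourier_add, e₁, e₂, add_mul]⟩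

theorem mul (hp : IsFourierSymbol p) (hq : IsFourierSymbol q) :
    IsFourierSymbol fun ξ => p ξ * q ξ := fun φ hφ => by
  obtain ⟨φ₂, h₂, e₂⟩ := hq φ hφ
  obtain ⟨φ₁, h₁, e₁⟩ := hp φ₂ h₂
  exact ⟨φ₁, h₁, fun ξ => by simp [e₁, e₂, mul_assoc]⟩

theorem sum {ι : Type*} (s : Finset ι) {p : ι → E → ℂ} (hp : ∀ i ∈ s, IsFourierSymbol (p i)) :
    IsFourierSymbol fun ξ => ∑ i ∈ s, p i ξ := by
  classical
  induction s using Finset.induction_on with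
  | empty => simpa using const (0 : ℂ)
  | insert a s ha ih =>
    simp only [Finset.sum_insert ha]
    exact (hp a (by simp)).add (ih fun i hi => hp i (by simp [hi]))

theorem prod {ι : Type*} (s : Finset ι) {p : ι → E → ℂ} (hp : ∀ i ∈ s, IsFourierSymbol (p i)) :
    IsFourierSymbol fun ξ => ∏ i ∈ s, p i ξ := by
  classical
  induction s using Finset.induction_on with
  | empty => simpa using const (1 : ℂ)
  | insert a s ha ih =>
    simp only [Finset.prod_insert ha]
    exact (hp a (by simp)).mul (ih fun i hi => hp i (by simp [hi]))

theorem pow (hp : IsFourierSymbol p) (n : ℕ) : IsFourierSymbol fun ξ => p ξ ^ n := by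
  simpa using prod (Finset.range n) (p := fun _ => p) fun _ _ => hp

/-- The Fourier transform turns `∂_a` into multiplication by `2πi ⟨ξ, a⟩`, and differentiation
preserves compact support. Sums and products then give all polynomial symbols. -/
theorem inner_left (a : E) : IsFourierSymbol fun ξ : E => ((inner ℝ ξ a : ℝ) : ℂ) := fun φ hφ => by
  refine ⟨(2 * Real.pi * Complex.I : ℂ)⁻¹ • ∂_{a} φ, ?_, fun ξ => ?_⟩
  · have : HasCompactSupport (∂_{a} φ : 𝓢(E, ℂ)) := by
      refine (hφ.fderiv (𝕜 := ℝ)).mono fun x hx h => hx ?_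
      rw [SchwartzMap.lineDerivOp_apply_eq_fderiv, h]; rfl
    exact this.mono fun x hx h => hx (by simp [h])
  · have ha : (inner ℝ · a).HasTemperateGrowth := ((innerSL ℝ).flip a).hasTemperateGrowth
    have h0 : (2 * Real.pi * Complex.I : ℂ) ≠ 0 := Complex.two_pi_I_ne_zero
    rw [FourierTransform.fourier_smul, SchwartzMap.fourier_lineDerivOp_eq, smul_smul,
      inv_mul_cancel₀ h0, one_smul, SchwartzMap.smulLeftCLM_apply_apply ha]
    simp

theorem clm (L : E →L[ℝ] ℝ) : IsFourierSymbol fun ξ : E => ((L ξ : ℝ) : ℂ) := by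
  have := inner_left ((InnerProductSpace.toDual ℝ E).symm L)
  have h (ξ : E) : inner ℝ ξ ((InnerProductSpace.toDual ℝ E).symm L) = L ξ := by
    rw [real_inner_comm]; exact InnerProductSpace.toDual_symm_apply
  simpa only [h] using this

theorem det {n : ℕ} (X : Fin n → Fin n → E →L[ℝ] ℝ) :
    IsFourierSymbol fun ξ : E => (((Matrix.of fun i j => X i j ξ).det : ℝ) : ℂ) := by
  simp only [Matrix.det_apply, Complex.ofReal_sum, Matrix.of_apply, Units.smul_def, zsmul_eq_mul,
    Complex.ofReal_mul, Complex.ofReal_prod, Complex.ofReal_intCast]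
  exact sum _ fun σ _ => (const _).mul (prod _ fun i _ => clm _)

end IsFourierSymbol
end FourierSymbol

section VanishingOrder
variable {E : Type*} [NormedAddCommGroup E] [NormedSpace ℝ E]

/-- In every Leibniz term the two orders add up to `n < a + b`, so one of the factors vanishes. -/
theorem iteratedFDeriv_mul_eq_zero {f g : E → ℂ} (hf : ContDiff ℝ ∞ f) (hg : ContDiff ℝ ∞ g)
    {x : E} {a b : ℕ} (hfa : ∀ n < a, iteratedFDeriv ℝ n f x = 0)
    (hgb : ∀ n < b, iteratedFDeriv ℝ n g x = 0) {n : ℕ} (hn : n < a + b) :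
    iteratedFDeriv ℝ n (fun y => f y * g y) x = 0 := by
  rw [← norm_le_zero_iff]
  refine (norm_iteratedFDeriv_mul_le hf hg x (n := n) (by exact_mod_cast le_top)).trans ?_
  refine (Finset.sum_eq_zero fun i hi => ?_).le
  rcases lt_or_ge i a with h | h
  · simp [hfa i h]
  · have : n - i < b := by have := Finset.mem_range.1 hi; omega
    simp [hgb _ this]

theorem iteratedFDeriv_pow_mul_eq_zero {p g : E → ℂ} (hp : ContDiff ℝ ∞ p) (hg : ContDiff ℝ ∞ g)
    {x : E} (hx : p x = 0) (t : ℕ) : ∀ n < t, iteratedFDeriv ℝ n (fun y => p y ^ t * g y) x = 0 := by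
  induction t with
  | zero => simp
  | succ t ih =>
    intro n hn
    have : (fun y => p y ^ (t + 1) * g y) = fun y => p y * (p y ^ t * g y) := by
      ext y; ring
    rw [this]
    refine iteratedFDeriv_mul_eq_zero hp ((hp.pow t).mul hg) (a := 1) (b := t) ?_ ih (by omega)
    intro m hm
    obtain rfl : m = 0 := by omega
    ext v; simp [hx]

end VanishingOrder

variable {d : ℕ}

theorem norm_partialDeriv_le {n : ℕ} (v : Fin n → Fin d) (f : EuclideanSpace ℝ (Fin d) → ℂ)
    (ξ : EuclideanSpace ℝ (Fin d)) : ‖partialDeriv v f ξ‖ ≤ ‖iteratedFDeriv ℝ n f ξ‖ := by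
  refine (ContinuousMultilinearMap.le_opNorm _ _).trans ?_
  simp

theorem schwartzNorm_lt_top (r m : ℕ) (f : 𝓢(EuclideanSpace ℝ (Fin d), ℂ)) :
    schwartzNorm r m f < ⊤ := by
  have h : ∀ x, ∀ n ≤ r, (1 + ‖x‖) ^ m * ‖iteratedFDeriv ℝ n f x‖ ≤
      2 ^ m * ((Finset.Iic (m, r)).sup fun m => SchwartzMap.seminorm ℝ m.1 m.2) f :=
    fun x n hn => SchwartzMap.one_add_le_sup_seminorm_apply (𝕜 := ℝ) (m := (m, r)) le_rfl hn f x
  set C := 2 ^ m * ((Finset.Iic (m, r)).sup fun m => SchwartzMap.seminorm ℝ m.1 m.2) f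
  refine lt_of_le_of_lt (b := ENNReal.ofReal C) ?_ ENNReal.ofReal_lt_top
  refine iSup_le fun n => iSup_le fun hn => iSup_le fun v => iSup_le fun x => ?_
  rw [← ofReal_norm, ← ENNReal.ofReal_mul (by positivity)]
  refine ENNReal.ofReal_le_ofReal (le_trans ?_ (h x n hn))
  gcongr
  exact norm_partialDeriv_le v f x

/-- The wavelet has transform `p^t φ̂`, where `φ` is a bump function and `p` the determinant from
`exists_det_ne_zero`. -/
theorem exists_compactlySupported_wavelet {H : Subgroup (GL (Fin d) ℝ)}
    {O : Set (EuclideanSpace ℝ (Fin d))} (hH : IsClosed (H : Set (GL (Fin d) ℝ)))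
    (hO : IsOpenDualOrbit H O) (ℓ t : ℕ) :
    ∃ ψ : EuclideanSpace ℝ (Fin d) → ℂ, ψ ≠ 0 ∧ HasCompactSupport ψ ∧ WaveletCondition O ℓ t ψ := by
  obtain ⟨X, ⟨ξ₁, h₁⟩, hX⟩ := hO.exists_det_ne_zero hH
  set p : EuclideanSpace ℝ (Fin d) → ℂ := fun ξ => (((Matrix.of fun i j => X j ξ i).det : ℝ) : ℂ) with hp
  have hps : IsFourierSymbol p :=
    IsFourierSymbol.det fun i j => (EuclideanSpace.proj (𝕜 := ℝ) i).comp (X j)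
  have hpsm : ContDiff ℝ ∞ p := by
    refine (Complex.ofRealCLM.contDiff (n := ((⊤ : ℕ∞) : WithTop ℕ∞))).comp ?_
    change ContDiff ℝ _ fun ξ => (Matrix.of fun i j => X j ξ i).det
    simp only [Matrix.det_apply, Matrix.of_apply]
    refine ContDiff.sum fun σ _ => ContDiff.const_smul _ (contDiff_prod fun i _ => ?_)
    exact ((EuclideanSpace.proj (𝕜 := ℝ) (σ i)).comp (X i)).contDiff
  have hph (c : ℝ) : p (c • ξ₁) = (c : ℂ) ^ d * p ξ₁ := by
    simp only [hp]
    have : (Matrix.of fun i j => X j (c • ξ₁) i) = c • (Matrix.of fun i j => X j ξ₁ i) := by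
      ext i j; simp
    rw [this, Matrix.det_smul]; simp
  let B : ContDiffBump (0 : EuclideanSpace ℝ (Fin d)) := default
  let φf : EuclideanSpace ℝ (Fin d) → ℂ := fun x => ((B x : ℝ) : ℂ)
  have hφs : ContDiff ℝ ∞ φf := Complex.ofRealCLM.contDiff.comp B.contDiff
  have hφc : HasCompactSupport φf := B.hasCompactSupport.comp_left (g := fun r : ℝ => (r : ℂ)) (by simp)
  let φ : 𝓢(EuclideanSpace ℝ (Fin d), ℂ) := hφc.toSchwartzMap hφs
  have hφ0 : (𝓕 φ) 0 ≠ 0 := by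
    have : (𝓕 φ) 0 = ((∫ x, B x : ℝ) : ℂ) := by
      rw [SchwartzMap.fourier_coe, Real.fourier_eq]
      simp [φ, φf, integral_complex_ofReal]
    rw [this]
    exact_mod_cast (B.integral_pos (μ := volume)).ne'
  obtain ⟨ψ, hψc, hψ⟩ := (hps.pow t) φ hφc
  have hψ' : (𝓕 (ψ : EuclideanSpace ℝ (Fin d) → ℂ)) = fun ξ => p ξ ^ t * (𝓕 φ) ξ := by
    rw [← SchwartzMap.fourier_coe]; exact funext hψ
  refine ⟨ψ, ?_, hψc, ψ.integrable, ψ.smooth _, ⟨ψ.integrable, ?_, ?_⟩, ?_⟩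
  · intro h0
    have h2 : ∀ ξ, p ξ ^ t * (𝓕 φ) ξ = 0 := fun ξ => by
      have := congrFun hψ' ξ
      rw [← this, h0]
      simp [Real.fourier_eq]
    -- Only `φ̂(0) = ∫ φ ≠ 0` is known. Homogeneity of `p` allows `ξ₁` to be scaled into a
    -- neighbourhood of `0` where `φ̂` does not vanish, keeping `p ≠ 0`.
    have hev : ∀ᶠ c : ℝ in 𝓝[≠] 0, (𝓕 φ) (c • ξ₁) ≠ 0 := by
      have hc : Continuous fun c : ℝ => (𝓕 φ) (c • ξ₁) :=
        (𝓕 φ).continuous.comp (continuous_id.smul continuous_const)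
      exact nhdsWithin_le_nhds (hc.continuousAt.eventually_ne (by simpa using hφ0))
    obtain ⟨c, hc, hc0⟩ := (hev.and self_mem_nhdsWithin).exists
    rcases mul_eq_zero.1 (h2 (c • ξ₁)) with h | h
    · have := eq_zero_of_pow_eq_zero h
      rw [hph] at this
      have hc0' : c ≠ 0 := hc0
      rcases mul_eq_zero.1 this with h | h
      · exact hc0' (by exact_mod_cast eq_zero_of_pow_eq_zero h)
      · exact h₁ (Complex.ofReal_eq_zero.1 h)
    · exact hc h
  · rw [← SchwartzMap.fourier_coe]; exact (𝓕 ψ).smooth _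
  · intro n hn v ξ hξ
    rw [hψ', partialDeriv, iteratedFDeriv_pow_mul_eq_zero hpsm ((𝓕 φ).smooth ⊤) (by
      simp only [hp]; rw [hX ξ hξ]; simp) t n hn]
    rfl
  · rw [← SchwartzMap.fourier_coe]; exact schwartzNorm_lt_top t t _

end WaveletCoorbit

/-! ### Vanishing on the cone and bounds by powers of `A`. -/

namespace WaveletCoorbit
open Filter
variable {d : ℕ}

/-- Expansion in the standard basis; this passes from partial derivatives to operator norms of
iterated derivatives. -/
theorem norm_multilinear_le_sum {n : ℕ}
    (T : ContinuousMultilinearMap ℝ (fun _ : Fin n => EuclideanSpace ℝ (Fin d)) ℂ) :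
    ‖T‖ ≤ ∑ v : Fin n → Fin d, ‖T fun j => EuclideanSpace.single (v j) (1 : ℝ)‖ := by
  refine T.opNorm_le_bound (Finset.sum_nonneg fun _ _ => norm_nonneg _) fun m => ?_
  have hm : m = fun i => ∑ j, m i j • EuclideanSpace.single j (1 : ℝ) := by
    funext i
    ext k
    simp [Pi.single_apply]
  conv_lhs => rw [hm]
  rw [ContinuousMultilinearMap.map_sum, Finset.sum_mul]
  refine (norm_sum_le _ _).trans (Finset.sum_le_sum fun v _ => ?_)
  rw [ContinuousMultilinearMap.map_smul_univ, norm_smul, mul_comm]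
  refine mul_le_mul_of_nonneg_left ?_ (norm_nonneg _)
  rw [norm_prod]
  exact Finset.prod_le_prod (fun _ _ => norm_nonneg _) fun i _ => PiLp.norm_apply_le (m i) (v i)

theorem exists_bound_of_schwartzNorm {r m : ℕ} {f : EuclideanSpace ℝ (Fin d) → ℂ}
    (hf : schwartzNorm r m f < ∞) :
    ∃ C : ℝ, 0 ≤ C ∧ ∀ n ≤ r, ∀ x, ‖iteratedFDeriv ℝ n f x‖ ≤ C * ((1 + ‖x‖) ^ m)⁻¹ := by
  set S := (schwartzNorm r m f).toReal
  refine ⟨∑ n ∈ Finset.range (r + 1), ∑ _v : Fin n → Fin d, S, ?_, fun n hn x => ?_⟩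
  · exact Finset.sum_nonneg fun _ _ => Finset.sum_nonneg fun _ _ => ENNReal.toReal_nonneg
  have hpos : 0 < (1 + ‖x‖) ^ m := by positivity
  rw [← div_eq_mul_inv, le_div_iff₀ hpos]
  have h1 : ∀ v : Fin n → Fin d, (1 + ‖x‖) ^ m * ‖partialDeriv v f x‖ ≤ S := by
    intro v
    have : ENNReal.ofReal ((1 + ‖x‖) ^ m) * ‖partialDeriv v f x‖ₑ ≤ schwartzNorm r m f :=
      le_iSup_of_le n (le_iSup_of_le hn (le_iSup_of_le v (le_iSup_of_le x le_rfl)))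
    rw [← ofReal_norm, ← ENNReal.ofReal_mul hpos.le] at this
    exact (ENNReal.ofReal_le_iff_le_toReal hf.ne).1 this
  calc ‖iteratedFDeriv ℝ n f x‖ * (1 + ‖x‖) ^ m
      ≤ (∑ v : Fin n → Fin d, ‖partialDeriv v f x‖) * (1 + ‖x‖) ^ m := by
        gcongr; exact norm_multilinear_le_sum _
    _ = ∑ v : Fin n → Fin d, (1 + ‖x‖) ^ m * ‖partialDeriv v f x‖ := by
        rw [Finset.sum_mul]; simp_rw [mul_comm]
    _ ≤ ∑ _v : Fin n → Fin d, S := Finset.sum_le_sum fun v _ => h1 v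
    _ ≤ _ := Finset.single_le_sum (f := fun n => ∑ _v : Fin n → Fin d, S)
        (fun _ _ => Finset.sum_nonneg fun _ _ => ENNReal.toReal_nonneg)
        (Finset.mem_range.2 (by omega))

theorem iteratedFDeriv_eq_zero_of_partialDeriv {n : ℕ} {f : EuclideanSpace ℝ (Fin d) → ℂ}
    {x : EuclideanSpace ℝ (Fin d)} (h : ∀ v : Fin n → Fin d, partialDeriv v f x = 0) :
    iteratedFDeriv ℝ n f x = 0 := by
  rw [← norm_le_zero_iff]
  refine (norm_multilinear_le_sum _).trans (Finset.sum_eq_zero fun v _ => ?_).le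
  rw [norm_eq_zero]; exact h v

/-- A Taylor estimate by descent from order `t`: each use of the mean value inequality on a segment
from `x₀` lowers the order by one and gains one factor of the distance. -/
theorem norm_iteratedFDeriv_le_of_vanish {E F : Type*} [NormedAddCommGroup E] [NormedSpace ℝ E]
    [NormedAddCommGroup F] [NormedSpace ℝ F] {t : ℕ} {f : E → F} (hf : ContDiff ℝ t f) {x₀ x : E}
    (h0 : ∀ n < t, iteratedFDeriv ℝ n f x₀ = 0) {M : ℝ} (hM0 : 0 ≤ M)
    (hM : ∀ z ∈ segment ℝ x₀ x, ‖iteratedFDeriv ℝ t f z‖ ≤ M) {k : ℕ} (hk : k ≤ t) :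
    ‖iteratedFDeriv ℝ k f x‖ ≤ M * ‖x - x₀‖ ^ (t - k) := by
  suffices H : ∀ j ≤ t, ∀ z ∈ segment ℝ x₀ x,
      ‖iteratedFDeriv ℝ (t - j) f z‖ ≤ M * ‖z - x₀‖ ^ j by
    have := H (t - k) (by omega) x (right_mem_segment ℝ x₀ x)
    rwa [Nat.sub_sub_self hk] at this
  intro j
  induction j with
  | zero => intro _ z hz; simpa using hM z hz
  | succ j ih =>
    intro hj z hz
    have hsub : segment ℝ x₀ z ⊆ segment ℝ x₀ x :=
      (convex_segment x₀ x).segment_subset (left_mem_segment ℝ x₀ x) hz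
    have e : t - j = t - (j + 1) + 1 := by omega
    have hd : Differentiable ℝ (iteratedFDeriv ℝ (t - (j + 1)) f) :=
      hf.differentiable_iteratedFDeriv (by exact_mod_cast (by omega : t - (j + 1) < t))
    have := (convex_segment x₀ z).norm_image_sub_le_of_norm_fderiv_le (𝕜 := ℝ)
      (f := iteratedFDeriv ℝ (t - (j + 1)) f) (C := M * ‖z - x₀‖ ^ j)
      (fun y _ => hd y) (fun y hy => ?_) (left_mem_segment ℝ x₀ z) (right_mem_segment ℝ x₀ z)
    · rw [h0 _ (by omega), sub_zero] at this
      rwa [pow_succ, ← mul_assoc]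
    · rw [norm_fderiv_iteratedFDeriv, ← e]
      refine (ih (by omega) y (hsub hy)).trans ?_
      gcongr
      obtain ⟨θ, hθ, rfl⟩ := (segment_eq_image' ℝ x₀ z ▸ hy : y ∈ _ '' _)
      simp only [add_sub_cancel_left, norm_smul, Real.norm_of_nonneg hθ.1]
      exact mul_le_of_le_one_left (norm_nonneg _) hθ.2

/-- The nearest point of a closed cone. -/
theorem exists_nearest_of_cone {E : Type*} [NormedAddCommGroup E] [InnerProductSpace ℝ E]
    [FiniteDimensional ℝ E] {Z : Set E} (hZ : IsClosed Z) (hne : Z.Nonempty)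
    (hcone : ∀ (c : ℝ), ∀ z ∈ Z, c • z ∈ Z) (x : E) :
    ∃ z ∈ Z, ‖x - z‖ = Metric.infDist x Z ∧ ‖z‖ = √(‖x‖ ^ 2 - Metric.infDist x Z ^ 2) ∧
      ∀ y ∈ segment ℝ z x, ‖z‖ ≤ ‖y‖ := by
  have : ProperSpace E := FiniteDimensional.proper ℝ E
  obtain ⟨z, hz, hd⟩ := hZ.exists_infDist_eq_dist hne x
  have hort : inner ℝ z (x - z) = 0 := by
    by_cases hz0 : z = 0
    · simp [hz0]
    have hzp : 0 < ‖z‖ ^ 2 := by positivity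
    -- `(1 + c) • z` is the orthogonal projection of `x` onto the line through `z`. It lies in the
    -- cone, so minimality of `z` forces `c = 0`; the remaining claims are Pythagoras.
    set c := inner ℝ z (x - z) / ‖z‖ ^ 2 with hc
    have h1 : ‖x - z‖ ≤ ‖x - (1 + c) • z‖ := by
      rw [← dist_eq_norm, ← dist_eq_norm, ← hd]
      exact Metric.infDist_le_dist_of_mem (hcone _ z hz)
    have h2 : ‖x - (1 + c) • z‖ ^ 2 = ‖x - z‖ ^ 2 - c ^ 2 * ‖z‖ ^ 2 := by
      have : x - (1 + c) • z = (x - z) - c • z := by module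
      rw [this, norm_sub_sq_real, inner_smul_right, norm_smul, mul_pow, Real.norm_eq_abs, sq_abs,
        real_inner_comm]
      have : inner ℝ z (x - z) = c * ‖z‖ ^ 2 := by rw [hc]; field_simp
      rw [this]; ring
    have h3 : ‖x - z‖ ^ 2 ≤ ‖x - (1 + c) • z‖ ^ 2 := by gcongr
    have h4 : c ^ 2 * ‖z‖ ^ 2 ≤ 0 := by linarith
    have h5 : c = 0 := by
      by_contra h
      have : 0 < c ^ 2 := by positivity
      nlinarith
    rw [hc, div_eq_zero_iff] at h5
    exact h5.resolve_right hzp.ne'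
  have key (θ : ℝ) : ‖z + θ • (x - z)‖ ^ 2 = ‖z‖ ^ 2 + θ ^ 2 * ‖x - z‖ ^ 2 := by
    rw [norm_add_sq_real, inner_smul_right, hort, norm_smul, mul_pow, Real.norm_eq_abs, sq_abs]
    ring
  refine ⟨z, hz, ?_, ?_, ?_⟩
  · rw [hd, dist_eq_norm]
  · have := key 1
    rw [one_smul, add_sub_cancel] at this
    rw [hd, dist_eq_norm, this]
    simp [Real.sqrt_sq]
  · intro y hy
    obtain ⟨θ, hθ, rfl⟩ := (segment_eq_image' ℝ z x ▸ hy : y ∈ _ '' _)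
    rw [← abs_of_nonneg (norm_nonneg z), ← abs_of_nonneg (norm_nonneg (z + θ • (x - z))), ← sq_le_sq,
      key]
    nlinarith [sq_nonneg (θ * ‖x - z‖)]

theorem auxA_nonneg (O : Set (EuclideanSpace ℝ (Fin d))) (ξ) : 0 ≤ auxA O ξ :=
  le_min (div_nonneg Metric.infDist_nonneg (by positivity)) (by positivity)

theorem auxA_le_one (O : Set (EuclideanSpace ℝ (Fin d))) (ξ) : auxA O ξ ≤ 1 := by
  refine (min_le_right _ _).trans ?_
  rw [div_le_one (by positivity)]
  linarith [norm_nonneg ξ]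

theorem continuous_auxA (O : Set (EuclideanSpace ℝ (Fin d))) : Continuous (auxA O) := by
  have h : Continuous fun ξ => Metric.infDist ξ Oᶜ := Metric.continuous_infDist_pt _
  refine Continuous.min (h.div ?_ fun ξ => ?_) (continuous_const.div ?_ fun ξ => ?_)
  · fun_prop
  · positivity
  · fun_prop
  · positivity

/-- Decay of a function with vanishing derivatives on the complement of a conic open set. -/
theorem exists_norm_iteratedFDeriv_le_auxA {O : Set (EuclideanSpace ℝ (Fin d))} (hO : IsOpen O)
    (h0 : (0 : EuclideanSpace ℝ (Fin d)) ∉ O) (hcone : ∀ c : ℝ, c ≠ 0 → ∀ ξ ∈ O, c • ξ ∈ O)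
    {t ℓ : ℕ} {f : EuclideanSpace ℝ (Fin d) → ℂ} (hf : ContDiff ℝ t f)
    (hv : ∀ n < t, ∀ v : Fin n → Fin d, ∀ ξ ∈ Oᶜ, partialDeriv v f ξ = 0)
    (hs : schwartzNorm t t f < ∞) :
    ∃ C : ℝ, 0 ≤ C ∧ ∀ k, k + ℓ ≤ t → ∀ ξ, ‖iteratedFDeriv ℝ k f ξ‖ ≤ C * auxA O ξ ^ ℓ := by
  obtain ⟨C, hC, hb⟩ := exists_bound_of_schwartzNorm hs
  refine ⟨C, hC, fun k hk ξ => ?_⟩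
  have hcone' : ∀ c : ℝ, ∀ z ∈ Oᶜ, c • z ∈ Oᶜ := by
    intro c z hz hcz
    rcases eq_or_ne c 0 with rfl | hc
    · rw [zero_smul] at hcz; exact h0 hcz
    · apply hz
      have := hcone c⁻¹ (inv_ne_zero hc) _ hcz
      rwa [inv_smul_smul₀ hc] at this
  obtain ⟨z, hz, hd, hn, hseg⟩ := exists_nearest_of_cone hO.isClosed_compl ⟨0, h0⟩ hcone' ξ
  have hkt : k ≤ t := by omega
  suffices H : ‖iteratedFDeriv ℝ k f ξ‖ ≤ C * auxA O ξ ^ (t - k) by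
    refine H.trans (mul_le_mul_of_nonneg_left ?_ hC)
    exact pow_le_pow_of_le_one (auxA_nonneg O ξ) (auxA_le_one O ξ) (by omega)
  -- In the first case the Taylor estimate starts at the nearest point `z`: on the segment norms are
  -- at least `‖z‖`, so the `t`-th derivative is at most `C (1 + ‖z‖)^{-t}`, and `1 + ‖z‖` is the
  -- denominator in `A`. In the second case the decay of the derivatives suffices.
  rcases le_total (Metric.infDist ξ Oᶜ / (1 + √(‖ξ‖ ^ 2 - Metric.infDist ξ Oᶜ ^ 2)))
    (1 / (1 + ‖ξ‖)) with h | h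
  · rw [auxA, min_eq_left h, ← hn, ← hd]
    have := norm_iteratedFDeriv_le_of_vanish hf (x₀ := z) (x := ξ) (k := k)
      (M := C * ((1 + ‖z‖) ^ t)⁻¹)
      (fun n hn => iteratedFDeriv_eq_zero_of_partialDeriv fun v => hv n hn v z hz) (by positivity)
      (fun y hy => (hb t le_rfl y).trans ?_) hkt
    · refine this.trans ?_
      rw [mul_assoc, div_pow, div_eq_inv_mul]
      gcongr
      · linarith [norm_nonneg z]
      · omega
    · have := hseg y hy
      gcongr
  · rw [auxA, min_eq_right h]
    refine (hb k hkt ξ).trans ?_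
    rw [one_div, inv_pow]
    gcongr
    · linarith [norm_nonneg ξ]
    · omega

end WaveletCoorbit

/-! ### Fourier decay and the wavelet transform on the Fourier side. -/

namespace WaveletCoorbit
open Filter

section General
variable {E : Type*} [NormedAddCommGroup E] [InnerProductSpace ℝ E] [FiniteDimensional ℝ E]
  [MeasurableSpace E] [BorelSpace E]

/-- Differentiability of a function gives decay of its Fourier transform. -/
theorem exists_fourier_decay (E : Type*) [NormedAddCommGroup E] [InnerProductSpace ℝ E]
    [FiniteDimensional ℝ E] [MeasurableSpace E] [BorelSpace E] (N : ℕ) :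
    ∃ c : ℝ, 0 ≤ c ∧ ∀ (g : E → ℂ) (a : E → ℝ) (K : ℝ), ContDiff ℝ N g → Integrable a →
      (∀ n ≤ N, ∀ ξ, ‖iteratedFDeriv ℝ n g ξ‖ ≤ K * a ξ) →
      ∀ x, ‖𝓕 g x‖ ≤ c * (K * ∫ ξ, a ξ) * ((1 + ‖x‖) ^ N)⁻¹ := by
  -- `2 ^ (N - 1)` comes from `(1 + r)^N ≤ 2^{N-1} (1 + r^N)`; the factor `2 ^ N * (N + 1)` comes
  -- from bounding `‖x‖^N ‖ĝ(x)‖` by the `L¹` norms of the derivatives of orders `0, …, N`.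
  refine ⟨2 ^ (N - 1) * (1 + 2 ^ N * (N + 1)), by positivity, fun g a K hg ha hb x => ?_⟩
  have hint : ∀ n ≤ N, Integrable fun v => ‖iteratedFDeriv ℝ n g v‖ := by
    intro n hn
    refine (ha.const_mul K).mono' ?_ (Eventually.of_forall fun v => ?_)
    · exact (hg.continuous_iteratedFDeriv (by exact_mod_cast hn)).norm.aestronglyMeasurable
    · rw [norm_norm]; exact hb n hn v
  have hle : ∀ n ≤ N, ∫ v, ‖iteratedFDeriv ℝ n g v‖ ≤ K * ∫ ξ, a ξ := by
    intro n hn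
    rw [← integral_const_mul]
    exact integral_mono (hint n hn) (ha.const_mul K) (hb n hn)
  have h'f : ∀ (k n : ℕ), (k : ℕ∞) ≤ (0 : ℕ) → (n : ℕ∞) ≤ N →
      Integrable fun v => ‖v‖ ^ k * ‖iteratedFDeriv ℝ n g v‖ := by
    intro k n hk hn
    have hk0 : k = 0 := by simpa using hk
    subst hk0
    simpa using hint n (by exact_mod_cast hn)
  have h0 : ‖𝓕 g x‖ ≤ K * ∫ ξ, a ξ := by
    refine le_trans ?_ (hle 0 (Nat.zero_le _))
    simp only [norm_iteratedFDeriv_zero]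
    exact VectorFourier.norm_fourierIntegral_le_integral_norm _ _ _ _ _
  have hN : ‖x‖ ^ N * ‖𝓕 g x‖ ≤ 2 ^ N * (N + 1) * (K * ∫ ξ, a ξ) := by
    have := Real.pow_mul_norm_iteratedFDeriv_fourier_le (K := (0 : ℕ)) (N := N)
      (by exact_mod_cast hg) h'f (k := 0) (n := N) le_rfl le_rfl x
    simp only [norm_iteratedFDeriv_zero, pow_zero, one_mul, Nat.cast_zero, mul_zero, zero_add,
      Finset.range_one, Finset.singleton_product, Finset.sum_map, Function.Embedding.coeFn_mk] at this
    refine this.trans ?_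
    rw [mul_assoc]
    gcongr
    refine (Finset.sum_le_card_nsmul _ _ (K * ∫ ξ, a ξ) fun n hn => ?_).trans ?_
    · exact hle n (by have := Finset.mem_range.1 hn; omega)
    · simp
  rw [← div_eq_mul_inv, le_div_iff₀ (by positivity)]
  calc ‖𝓕 g x‖ * (1 + ‖x‖) ^ N ≤ ‖𝓕 g x‖ * (2 ^ (N - 1) * (1 ^ N + ‖x‖ ^ N)) := by
        gcongr
        exact add_pow_le zero_le_one (norm_nonneg x) N
    _ = 2 ^ (N - 1) * (‖𝓕 g x‖ + ‖x‖ ^ N * ‖𝓕 g x‖) := by ring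
    _ ≤ 2 ^ (N - 1) * ((K * ∫ ξ, a ξ) + 2 ^ N * (N + 1) * (K * ∫ ξ, a ξ)) := by gcongr
    _ = _ := by ring

/-- The binomial coefficients of the Leibniz rule sum to `2 ^ n`, and the chain rule for the inner
map `B` costs at most `(1 + ‖B‖) ^ N`. -/
theorem norm_iteratedFDeriv_mul_conj_comp_le {E : Type*} [NormedAddCommGroup E] [NormedSpace ℝ E]
    {t : ℕ} {f : E → ℂ} (hf : ContDiff ℝ t f) (B : E →L[ℝ] E) {a : E → ℝ} {C : ℝ} (hC : 0 ≤ C)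
    {N : ℕ} (hN : N ≤ t) (hb : ∀ k ≤ N, ∀ ξ, ‖iteratedFDeriv ℝ k f ξ‖ ≤ C * a ξ) {n : ℕ} (hn : n ≤ N)
    (ha : ∀ ξ, 0 ≤ a ξ) (ξ : E) :
    ‖iteratedFDeriv ℝ n (fun η => f η * (starRingEnd ℂ) (f (B η))) ξ‖ ≤
      C ^ 2 * (2 * (1 + ‖B‖)) ^ N * (a ξ * a (B ξ)) := by
  have hc : ContDiff ℝ t fun η => (starRingEnd ℂ) (f (B η)) :=
    Complex.conjCLE.contDiff.comp (hf.comp B.contDiff)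
  have h2 : ∀ k ≤ N, ‖iteratedFDeriv ℝ k (fun η => (starRingEnd ℂ) (f (B η))) ξ‖
      ≤ C * a (B ξ) * (1 + ‖B‖) ^ N := by
    intro k hk
    have e : (fun η => (starRingEnd ℂ) (f (B η))) = Complex.conjLIE ∘ (f ∘ B) := rfl
    rw [e, LinearIsometryEquiv.norm_iteratedFDeriv_comp_left,
      B.iteratedFDeriv_comp_right hf ξ (by exact_mod_cast hk.trans hN)]
    refine (ContinuousMultilinearMap.norm_compContinuousLinearMap_le _ _).trans ?_
    rw [Finset.prod_const, Finset.card_univ, Fintype.card_fin]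
    have h3 : ‖B‖ ^ k ≤ (1 + ‖B‖) ^ N :=
      (pow_le_pow_left₀ (norm_nonneg _) (by linarith) k).trans
        (pow_le_pow_right₀ (by linarith [norm_nonneg B]) hk)
    have := hb k hk (B ξ)
    have := ha (B ξ)
    gcongr
  refine (norm_iteratedFDeriv_mul_le hf hc ξ (by exact_mod_cast hn.trans hN)).trans ?_
  have hterm : ∀ i ∈ Finset.range (n + 1), (n.choose i : ℝ) * ‖iteratedFDeriv ℝ i f ξ‖ *
      ‖iteratedFDeriv ℝ (n - i) (fun η => (starRingEnd ℂ) (f (B η))) ξ‖ ≤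
      n.choose i * (C * a ξ * (C * a (B ξ) * (1 + ‖B‖) ^ N)) := by
    intro i hi
    have hi' := Finset.mem_range.1 hi
    rw [mul_assoc]
    have h1 := hb i (by omega) ξ
    have h3 := h2 (n - i) (by omega)
    have := ha ξ
    gcongr
  refine (Finset.sum_le_sum hterm).trans ?_
  rw [← Finset.sum_mul]
  have hs : (∑ i ∈ Finset.range (n + 1), (n.choose i : ℝ)) = 2 ^ n := by
    exact_mod_cast Nat.sum_range_choose n
  rw [hs, mul_pow]
  have h5 : (2 : ℝ) ^ n ≤ 2 ^ N := pow_le_pow_right₀ one_le_two hn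
  have := ha ξ
  have := ha (B ξ)
  calc (2 : ℝ) ^ n * (C * a ξ * (C * a (B ξ) * (1 + ‖B‖) ^ N))
      ≤ 2 ^ N * (C * a ξ * (C * a (B ξ) * (1 + ‖B‖) ^ N)) := by gcongr
    _ = _ := by ring

end General

variable {d : ℕ} {H : Subgroup (GL (Fin d) ℝ)}

instance instSecondCountableSubgroupGL : SecondCountableTopology H := by
  have h1 : SecondCountableTopology (Matrix (Fin d) (Fin d) ℝ) :=
    inferInstanceAs (SecondCountableTopology (Fin d → Fin d → ℝ))
  have h2 : SecondCountableTopology (Matrix (Fin d) (Fin d) ℝ)ᵐᵒᵖ :=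
    MulOpposite.opHomeomorph.symm.isInducing.secondCountableTopology
  have h3 : SecondCountableTopology (GL (Fin d) ℝ) :=
    Units.isInducing_embedProduct.secondCountableTopology
  exact (IsInducing.subtypeVal (Y := GL (Fin d) ℝ)
    (t := {x | x ∈ H})).secondCountableTopology

theorem absDet_pos (h : H) : 0 < absDet h := by
  rw [absDet, abs_pos]
  intro h0
  have := congrArg Matrix.det (mat_mul_inv h)
  rw [Matrix.det_mul, h0, zero_mul, Matrix.det_one] at this
  exact zero_ne_one this

theorem absDet_mul (g h : H) : absDet (g * h) = absDet g * absDet h := by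
  rw [absDet, mat_mul, Matrix.det_mul, abs_mul]; rfl

theorem continuous_absDet : Continuous (absDet : H → ℝ) :=
  (Continuous.matrix_det continuous_mat).abs

theorem det_euclMap (M : Matrix (Fin d) (Fin d) ℝ) :
    LinearMap.det (euclMap M : EuclideanSpace ℝ (Fin d) →ₗ[ℝ] EuclideanSpace ℝ (Fin d)) = M.det := by
  have : (euclMap M : EuclideanSpace ℝ (Fin d) →ₗ[ℝ] EuclideanSpace ℝ (Fin d))
      = Matrix.toLin (EuclideanSpace.basisFun (Fin d) ℝ).toBasis
        (EuclideanSpace.basisFun (Fin d) ℝ).toBasis M := by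
    rfl
  rw [this, LinearMap.det_toLin]

/-- The dual action of `h` as a homeomorphism. -/
noncomputable def dualHomeo (h : H) : EuclideanSpace ℝ (Fin d) ≃ₜ EuclideanSpace ℝ (Fin d) where
  toFun := euclMap (mat h).transpose
  invFun := euclMap (mat h⁻¹).transpose
  left_inv ξ := euclMap_transpose_inv_apply h ξ
  right_inv ξ := by simpa using euclMap_transpose_inv_apply h⁻¹ ξ
  continuous_toFun := (euclMap (mat h).transpose).continuous
  continuous_invFun := (euclMap (mat h⁻¹).transpose).continuous

theorem map_dualHomeo (h : H) :
    Measure.map (dualHomeo h).toMeasurableEquiv (volume : Measure (EuclideanSpace ℝ (Fin d)))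
      = ENNReal.ofReal (absDet h)⁻¹ • volume := by
  have hdet : LinearMap.det (euclMap (mat h).transpose :
      EuclideanSpace ℝ (Fin d) →ₗ[ℝ] EuclideanSpace ℝ (Fin d)) = (mat h).det := by
    rw [det_euclMap, Matrix.det_transpose]
  have hne : (mat h).det ≠ 0 := abs_pos.1 (absDet_pos h)
  have hmap := Measure.map_linearMap_addHaar_eq_smul_addHaar
    (volume : Measure (EuclideanSpace ℝ (Fin d))) (hdet ▸ hne)
  rw [absDet, ← abs_inv, ← hdet]
  exact hmap

/-- Change of variables `η = hᵀ ξ`. -/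
theorem integral_comp_transpose (h : H) (F : EuclideanSpace ℝ (Fin d) → ℂ) :
    ((absDet h : ℝ) : ℂ) * ∫ ξ, F (euclMap (mat h).transpose ξ) = ∫ η, F η := by
  have h1 := integral_map_equiv (μ := volume) (dualHomeo h).toMeasurableEquiv F
  have hpos := absDet_pos h
  rw [map_dualHomeo, integral_smul_measure, ENNReal.toReal_ofReal (inv_nonneg.2 hpos.le)] at h1
  have h3 : ∫ ξ, F (euclMap (mat h).transpose ξ)
    = ∫ ξ, F ((dualHomeo h).toMeasurableEquiv ξ) := rfl
  rw [h3, ← h1, Complex.real_smul, ← mul_assoc, ← Complex.ofReal_mul, mul_inv_cancel₀ hpos.ne']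
  simp

theorem integrable_comp_transpose (h : H) {F : EuclideanSpace ℝ (Fin d) → ℂ} (hF : Integrable F) :
    Integrable fun ξ => F (euclMap (mat h).transpose ξ) := by
  have h1 := integrable_map_equiv (μ := volume) (dualHomeo h).toMeasurableEquiv F
  rw [map_dualHomeo] at h1
  exact h1.1 (hF.smul_measure ENNReal.ofReal_ne_top)

theorem inner_euclMap_transpose (M : Matrix (Fin d) (Fin d) ℝ) (x y : EuclideanSpace ℝ (Fin d)) :
    inner ℝ x (euclMap M.transpose y) = inner ℝ (euclMap M x) y := by
  rw [euclMap_transpose, ContinuousLinearMap.star_eq_adjoint, ContinuousLinearMap.adjoint_inner_right]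

theorem norm_euclMap_transpose (M : Matrix (Fin d) (Fin d) ℝ) :
    ‖euclMap M.transpose‖ = ‖euclMap M‖ := by
  rw [euclMap_transpose]; exact (ContinuousLinearMap.adjoint (𝕜 := ℝ)).norm_map _

/-- The wavelet transform on the Fourier side. -/
theorem waveletTransform_eq_fourierInv {ψ : EuclideanSpace ℝ (Fin d) → ℂ} (hc : Continuous ψ)
    (hi : Integrable ψ) (hf : Integrable (𝓕 ψ)) (hfc : Continuous (𝓕 ψ)) (a : AffineGroup H) :
    waveletTransform H ψ ψ a = ((absDet a.2 ^ (1 / 2 : ℝ) : ℝ) : ℂ) *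
      𝓕⁻ (fun ξ => 𝓕 ψ ξ * (starRingEnd ℂ) (𝓕 ψ (euclMap (mat a.2).transpose ξ))) a.1 := by
  obtain ⟨x, h⟩ := a
  set D := absDet h
  have hD : 0 < D := absDet_pos h
  set k : EuclideanSpace ℝ (Fin d) → ℂ := fun ξ =>
    Real.fourierChar (inner ℝ ξ x) • (starRingEnd ℂ) (𝓕 ψ (euclMap (mat h).transpose ξ)) with hk
  have hki : Integrable k := by
    refine (integrable_comp_transpose h hf).mono ?_ (Eventually.of_forall fun ξ => ?_)
    · refine Continuous.aestronglyMeasurable ?_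
      simp only [hk, Circle.smul_def]
      exact (continuous_subtype_val.comp (Real.continuous_fourierChar.comp (by fun_prop))).smul
        (Complex.continuous_conj.comp (hfc.comp (euclMap _).continuous))
    · simp [hk]
  have hinv : 𝓕⁻ (𝓕 ψ) = ψ := hc.fourierInv_fourier_eq hi hf
  -- Up to the factor `D`, the transform of `k` is the conjugated, translated and dilated wavelet.
  -- The identity `∫ ψ̂ k = ∫ ψ k̂` then takes the place of Plancherel.
  have hFk : ∀ y, (D : ℂ) * 𝓕 k y = (starRingEnd ℂ) (ψ (euclMap (mat h⁻¹) (y - x))) := by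
    intro y
    conv_rhs => rw [← hinv]
    rw [Real.fourierInv_eq, Real.fourier_eq, ← integral_conj]
    refine Eq.trans ?_ (integral_comp_transpose h _)
    congr 1
    refine integral_congr_ae (Eventually.of_forall fun ξ => ?_)
    have hin : inner ℝ (euclMap (mat h).transpose ξ) (euclMap (mat h⁻¹) (y - x))
        = inner ℝ ξ y - inner ℝ ξ x := by
      rw [real_inner_comm, inner_euclMap_transpose, ← euclMap_mat_mul, mul_inv_cancel,
        euclMap_mat_one, real_inner_comm, inner_sub_right]
    simp only [hk, hin, Circle.smul_def, smul_eq_mul, map_mul, ← Circle.coe_inv_eq_conj,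
      ← AddChar.map_neg_eq_inv]
    rw [← mul_assoc, ← Circle.coe_mul, ← AddChar.map_add_eq_mul]
    congr 3
    ring
  have hflip : ∫ ξ, 𝓕 ψ ξ * k ξ = ∫ y, ψ y * 𝓕 k y := by
    have := VectorFourier.integral_fourierIntegral_smul_eq_flip (μ := volume) (ν := volume)
      (L := innerₗ (EuclideanSpace ℝ (Fin d)))
      Real.continuous_fourierChar continuous_inner hi hki
    rw [flip_innerₗ] at this
    exact this
  have hpow : D ^ (-(1 / 2) : ℝ) * D = D ^ (1 / 2 : ℝ) := by
    nth_rw 2 [← Real.rpow_one D]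
    rw [← Real.rpow_add hD]; norm_num
  calc waveletTransform H ψ ψ (x, h)
      = ∫ y, ((D ^ (-(1 / 2) : ℝ) : ℝ) : ℂ) * (D * (ψ y * 𝓕 k y)) := by
        change ∫ y, ψ y * (starRingEnd ℂ) (quasiRegular (H := H) (x, h) ψ y) = _
        refine integral_congr_ae (Eventually.of_forall fun y => ?_)
        simp only [quasiRegular, map_mul, Complex.conj_ofReal, ← hFk]
        ring
    _ = ((D ^ (1 / 2 : ℝ) : ℝ) : ℂ) * ∫ ξ, 𝓕 ψ ξ * k ξ := by
        rw [integral_const_mul, integral_const_mul, ← hflip, ← hpow]; push_cast; ring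
    _ = _ := by
        congr 1
        rw [Real.fourierInv_eq]
        refine integral_congr_ae (Eventually.of_forall fun ξ => ?_)
        simp only [hk, Circle.smul_def, smul_eq_mul]
        ring

/-- Dominated convergence, with a multiple of `‖ψ‖` as the dominating function. -/
theorem continuous_waveletTransform {ψ : EuclideanSpace ℝ (Fin d) → ℂ} (hc : Continuous ψ)
    (hi : Integrable ψ) (hb : ∃ C, ∀ x, ‖ψ x‖ ≤ C) : Continuous (waveletTransform H ψ ψ) := by
  obtain ⟨C, hC⟩ := hb
  have hd : Continuous fun a : EuclideanSpace ℝ (Fin d) × H =>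
      ((absDet a.2 ^ (-(1 / 2) : ℝ) : ℝ) : ℂ) :=
    Complex.continuous_ofReal.comp ((continuous_absDet.comp continuous_snd).rpow_const
      fun a => Or.inl (absDet_pos a.2).ne')
  have key : Continuous fun a : EuclideanSpace ℝ (Fin d) × H =>
      ∫ y, ψ y * (starRingEnd ℂ) (ψ (euclMap (mat a.2⁻¹) (y - a.1))) := by
    refine continuous_of_dominated (bound := fun y => ‖ψ y‖ * C) (fun a => ?_) (fun a => ?_)
      (hi.norm.mul_const C) (Eventually.of_forall fun y => ?_)
    · refine Continuous.aestronglyMeasurable ?_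
      exact hc.mul (Complex.continuous_conj.comp (hc.comp ((euclMap _).continuous.comp
        (continuous_id.sub continuous_const))))
    · refine Eventually.of_forall fun y => ?_
      rw [norm_mul, RCLike.norm_conj]
      exact mul_le_mul_of_nonneg_left (hC _) (norm_nonneg _)
    · have h1 : Continuous fun a : EuclideanSpace ℝ (Fin d) × H => euclMap (mat a.2⁻¹) :=
        continuous_euclMap.comp (continuous_mat.comp continuous_snd.inv)
      exact continuous_const.mul (Complex.continuous_conj.comp (hc.comp
        (h1.clm_apply (continuous_const.sub continuous_fst))))
  have : waveletTransform H ψ ψ = fun a : EuclideanSpace ℝ (Fin d) × H =>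
      ((absDet a.2 ^ (-(1 / 2) : ℝ) : ℝ) : ℂ) *
        ∫ y, ψ y * (starRingEnd ℂ) (ψ (euclMap (mat a.2⁻¹) (y - a.1))) := by
    funext a
    rw [waveletTransform, ← integral_const_mul]
    refine integral_congr_ae (Eventually.of_forall fun y => ?_)
    simp only [quasiRegular, map_mul, Complex.conj_ofReal]
    ring
  rw [this]
  exact hd.mul key

end WaveletCoorbit

/-! ### Amalgam norms, weights and decay of the wavelet coefficients. -/

namespace WaveletCoorbit
open Filter

section Amalgam
variable {K : Type*} [Group K] [TopologicalSpace K] [IsTopologicalGroup K]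

theorem lowerSemicontinuous_localMax (U : Set K) {F : K → ℂ} (hF : Continuous F) :
    LowerSemicontinuous (localMax U F) := by
  refine lowerSemicontinuous_iSup fun y => lowerSemicontinuous_iSup fun _ => ?_
  exact ((hF.comp (continuous_mul_const y)).enorm).lowerSemicontinuous

/-- The amalgam condition does not depend on the choice of the neighbourhood. -/
theorem lintegral_localMax_lt_top [LocallyCompactSpace K] [SecondCountableTopology K]
    [MeasurableSpace K] [BorelSpace K] {μ : Measure K} [μ.IsHaarMeasure] {W V : Set K}
    (hW : W ∈ 𝓝 (1 : K)) (hV : IsCompact V) {m : K → ℝ} (hm : IsWeight m) {F : K → ℂ}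
    (hF : Continuous F) (h : ∫⁻ x, localMax W F x * ENNReal.ofReal (m x) ∂μ < ∞) :
    ∫⁻ x, localMax V F x * ENNReal.ofReal (m x) ∂μ < ∞ := by
  obtain ⟨T, -, hT⟩ := hV.elim_nhds_subcover (fun g => (fun x => g⁻¹ * x) ⁻¹' W) fun g _ => by
    refine (continuous_const_mul g⁻¹).continuousAt.preimage_mem_nhds ?_
    simpa using hW
  -- `V` is covered by finitely many translates `g W`, and `x y = (x g)(g⁻¹ y)`. Submultiplicativity
  -- then shifts the weight from `x` to `x g` at the cost of `m g⁻¹`.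
  have hle : ∀ x, localMax V F x ≤ ∑ g ∈ T, localMax W F (x * g) := by
    intro x
    refine iSup₂_le fun y hy => ?_
    obtain ⟨g, hg, hgy⟩ := Set.mem_iUnion₂.1 (hT hy)
    have h1 : ‖F (x * y)‖ₑ ≤ localMax W F (x * g) := by
      have : x * y = (x * g) * (g⁻¹ * y) := by group
      rw [this]
      exact le_iSup₂ (f := fun y _ => ‖F ((x * g) * y)‖ₑ) (g⁻¹ * y) hgy
    exact h1.trans (Finset.single_le_sum (f := fun g => localMax W F (x * g))
      (fun _ _ => zero_le) hg)
  have hmeas : Measurable fun x => localMax W F x * ENNReal.ofReal (m x) :=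
    (lowerSemicontinuous_localMax W hF).measurable.mul
      (ENNReal.measurable_ofReal.comp hm.continuous.measurable)
  calc ∫⁻ x, localMax V F x * ENNReal.ofReal (m x) ∂μ
      ≤ ∫⁻ x, ∑ g ∈ T, ENNReal.ofReal (m g⁻¹) *
          (localMax W F (x * g) * ENNReal.ofReal (m (x * g))) ∂μ := by
        refine lintegral_mono fun x => ?_
        refine (mul_le_mul_left (hle x) _).trans ?_
        rw [Finset.sum_mul]
        refine Finset.sum_le_sum fun g _ => ?_
        rw [mul_left_comm]
        refine mul_le_mul_right ?_ _
        rw [← ENNReal.ofReal_mul (hm.pos _).le, mul_comm]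
        refine ENNReal.ofReal_le_ofReal ?_
        simpa using hm.submul (x * g) g⁻¹
    _ = ∑ g ∈ T, ENNReal.ofReal (m g⁻¹) *
          ∫⁻ x, localMax W F (x * g) * ENNReal.ofReal (m (x * g)) ∂μ := by
        rw [lintegral_finsetSum]
        · refine Finset.sum_congr rfl fun g _ => ?_
          rw [lintegral_const_mul]
          exact hmeas.comp (continuous_mul_const g).measurable
        · intro g _
          exact (hmeas.comp (continuous_mul_const g).measurable).const_mul _
    _ < ∞ := by
        refine ENNReal.sum_lt_top.2 fun g _ => ENNReal.mul_lt_top ENNReal.ofReal_lt_top ?_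
        -- The image of `μ` under right translation is still left invariant, hence a multiple of
        -- `μ`.
        have h1 := lintegral_map (μ := μ) hmeas (continuous_mul_const g).measurable
        rw [← h1, Measure.isMulLeftInvariant_eq_smul (Measure.map (fun x => x * g) μ) μ,
          lintegral_smul_measure]
        exact ENNReal.mul_lt_top ENNReal.coe_lt_top h

end Amalgam

variable {d : ℕ} {H : Subgroup (GL (Fin d) ℝ)}

theorem norm_euclMap_mat_mul_le (g h : H) :
    1 + ‖euclMap (mat (g * h))‖ ≤ (1 + ‖euclMap (mat g)‖) * (1 + ‖euclMap (mat h)‖) := by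
  have h1 : ‖euclMap (mat (g * h))‖ ≤ ‖euclMap (mat g)‖ * ‖euclMap (mat h)‖ := by
    rw [mat_mul, euclMap_mul]; exact norm_mul_le _ _
  nlinarith [norm_nonneg (euclMap (mat g)), norm_nonneg (euclMap (mat h))]

theorem continuous_euclMap_mat : Continuous fun h : H => euclMap (mat h) :=
  continuous_euclMap.comp continuous_mat

/-- Submultiplicativity of the weight on `H` is what allows the neighbourhood in the embedding
condition to be changed. -/
theorem isWeight_mul_absDet_rpow_mul_norm {w₀ : H → ℝ} (hw : IsWeight w₀) (a : ℝ) {b : ℝ}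
    (hb : 0 ≤ b) :
    IsWeight fun h : H => w₀ h * absDet h ^ a * (1 + ‖euclMap (mat h)‖) ^ b where
  continuous := by
    refine (hw.continuous.mul (continuous_absDet.rpow_const fun h => Or.inl (absDet_pos h).ne')).mul ?_
    exact (continuous_const.add continuous_euclMap_mat.norm).rpow_const fun h => Or.inr hb
  pos h := by
    have := absDet_pos h
    have := hw.pos h
    positivity
  submul g h := by
    have h1 : (1 + ‖euclMap (mat (g * h))‖) ^ b ≤
        (1 + ‖euclMap (mat g)‖) ^ b * (1 + ‖euclMap (mat h)‖) ^ b := by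
      rw [← Real.mul_rpow (by positivity) (by positivity)]
      exact Real.rpow_le_rpow (by positivity) (norm_euclMap_mat_mul_le g h) hb
    have hg := absDet_pos g
    have hh := absDet_pos h
    have hwg := hw.pos g
    have hwh := hw.pos h
    have h2 := hw.submul g h
    rw [absDet_mul, Real.mul_rpow hg.le hh.le]
    calc w₀ (g * h) * (absDet g ^ a * absDet h ^ a) * (1 + ‖euclMap (mat (g * h))‖) ^ b
        ≤ (w₀ g * w₀ h) * (absDet g ^ a * absDet h ^ a) *
          ((1 + ‖euclMap (mat g)‖) ^ b * (1 + ‖euclMap (mat h)‖) ^ b) := by gcongr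
      _ = _ := by ring

/-- Peetre's inequality. -/
theorem one_add_norm_pow_inv_le {E : Type*} [NormedAddCommGroup E] (x y : E) (N : ℕ) :
    ((1 + ‖x + y‖) ^ N)⁻¹ ≤ ((1 + ‖x‖) ^ N)⁻¹ * (1 + ‖y‖) ^ N := by
  rw [← div_eq_inv_mul, inv_le_iff_one_le_mul₀ (by positivity), div_mul_eq_mul_div,
    le_div_iff₀ (by positivity), one_mul, ← mul_pow]
  refine pow_le_pow_left₀ (by positivity) ?_ N
  have : ‖x‖ ≤ ‖x + y‖ + ‖y‖ := by simpa using norm_sub_le (x + y) y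
  nlinarith [norm_nonneg y, norm_nonneg (x + y)]

/-- The integrand of `Φ_ℓ` is integrable, with integral `Φ_ℓ`. -/
theorem integrable_auxA_mul {O : Set (EuclideanSpace ℝ (Fin d))} {ℓ : ℕ} {h : H}
    (hfin : auxPhi O ℓ h ≠ ∞) :
    Integrable (fun ξ => auxA O ξ ^ ℓ * auxA O (euclMap (mat h).transpose ξ) ^ ℓ) ∧
    ∫ ξ, auxA O ξ ^ ℓ * auxA O (euclMap (mat h).transpose ξ) ^ ℓ = (auxPhi O ℓ h).toReal := by
  have hc : Continuous fun ξ => auxA O ξ ^ ℓ * auxA O (euclMap (mat h).transpose ξ) ^ ℓ :=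
    ((continuous_auxA O).pow ℓ).mul (((continuous_auxA O).comp (euclMap _).continuous).pow ℓ)
  have h0 : ∀ ξ, 0 ≤ auxA O ξ ^ ℓ * auxA O (euclMap (mat h).transpose ξ) ^ ℓ := fun ξ =>
    mul_nonneg (pow_nonneg (auxA_nonneg O _) _) (pow_nonneg (auxA_nonneg O _) _)
  refine ⟨⟨hc.aestronglyMeasurable, ?_⟩, ?_⟩
  · rw [hasFiniteIntegral_iff_ofReal (Eventually.of_forall h0)]
    exact lt_top_iff_ne_top.2 hfin
  · rw [integral_eq_lintegral_of_nonneg_ae (Eventually.of_forall h0) hc.aestronglyMeasurable]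
    rfl

/-- Facts on an admissible wavelet that follow from Fourier inversion. -/
theorem WaveletCondition.regularity {O : Set (EuclideanSpace ℝ (Fin d))} {ℓ t : ℕ}
    {ψ : EuclideanSpace ℝ (Fin d) → ℂ} (hψ : WaveletCondition O ℓ t ψ) (ht : d < t) :
    Continuous ψ ∧ Continuous (𝓕 ψ) ∧ Integrable (𝓕 ψ) ∧ ∃ C, ∀ x, ‖ψ x‖ ≤ C := by
  obtain ⟨hi, hs, ⟨-, hF, -⟩, hS⟩ := hψ
  obtain ⟨C, hC, hb⟩ := exists_bound_of_schwartzNorm hS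
  have hFi : Integrable (𝓕 ψ) := by
    have h1 : Integrable fun x : EuclideanSpace ℝ (Fin d) => C * (1 + ‖x‖) ^ (-(t : ℝ)) :=
      (integrable_one_add_norm (by simpa using ht)).const_mul C
    refine h1.mono' hF.continuous.aestronglyMeasurable (Eventually.of_forall fun x => ?_)
    have := hb 0 (Nat.zero_le _) x
    rw [norm_iteratedFDeriv_zero] at this
    rwa [Real.rpow_neg (by positivity), Real.rpow_natCast]
  refine ⟨hs.continuous, hF.continuous, hFi, ∫ ξ, ‖𝓕 ψ ξ‖, fun x => ?_⟩
  have hinv : 𝓕⁻ (𝓕 ψ) x = ψ x := congrFun (hs.continuous.fourierInv_fourier_eq hi hFi) x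
  rw [← hinv]
  exact VectorFourier.norm_fourierIntegral_le_integral_norm _ _ _ _ _

theorem memLp_two_of_integrable_of_bounded {α : Type*} [MeasurableSpace α] {μ : Measure α}
    {f : α → ℂ} (hf : Integrable f μ) {C : ℝ} (hb : ∀ x, ‖f x‖ ≤ C) : MemLp f 2 μ := by
  rw [memLp_two_iff_integrable_sq_norm hf.aestronglyMeasurable]
  refine (hf.norm.const_mul C).mono' (hf.aestronglyMeasurable.norm.pow 2)
    (Eventually.of_forall fun x => ?_)
  rw [Real.norm_of_nonneg (by positivity), pow_two]
  exact mul_le_mul_of_nonneg_right (hb x) (norm_nonneg _)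

/-- The decay of the wavelet coefficients. -/
theorem exists_norm_waveletTransform_le (hd : 0 < d) {O : Set (EuclideanSpace ℝ (Fin d))}
    (hO : IsOpenDualOrbit H O) {ℓ t N : ℕ} (hfin : ∀ h : H, auxPhi O ℓ h ≠ ∞)
    {ψ : EuclideanSpace ℝ (Fin d) → ℂ} (hψ : WaveletCondition O ℓ t ψ) (ht : d < t)
    (hN : N + ℓ ≤ t) :
    ∃ C : ℝ, 0 ≤ C ∧ ∀ a : AffineGroup H, ‖waveletTransform H ψ ψ a‖ ≤
      C * (absDet a.2 ^ (1 / 2 : ℝ) * (1 + ‖euclMap (mat a.2)‖) ^ N) * (auxPhi O ℓ a.2).toReal *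
        ((1 + ‖a.1‖) ^ N)⁻¹ := by
  obtain ⟨hc, hFc, hFi, -⟩ := hψ.regularity ht
  obtain ⟨hi, -, ⟨-, hF, hv⟩, hS⟩ := hψ
  obtain ⟨C, hC, hb⟩ := exists_norm_iteratedFDeriv_le_auxA (ℓ := ℓ) hO.2.1 (hO.zero_notMem hd)
    (fun c hc ξ hξ => hO.smul_mem hc hξ) hF hv hS
  obtain ⟨c, hc0, hdec⟩ := exists_fourier_decay (EuclideanSpace ℝ (Fin d)) N
  refine ⟨c * (C ^ 2 * 2 ^ N), by positivity, fun a => ?_⟩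
  generalize hx : a.1 = x
  generalize hh : a.2 = h
  have hNt : N ≤ t := by omega
  obtain ⟨hint, hval⟩ := integrable_auxA_mul (hfin h)
  have hsm : ContDiff ℝ N fun ξ => 𝓕 ψ ξ * (starRingEnd ℂ) (𝓕 ψ (euclMap (mat h).transpose ξ)) :=
    (hF.mul (Complex.conjCLE.contDiff.comp (hF.comp (euclMap _).contDiff))).of_le
      (by exact_mod_cast hNt)
  have h1 := hdec _ _ (C ^ 2 * (2 * (1 + ‖euclMap (mat h)‖)) ^ N) hsm hint (fun n hn ξ => by
    have := norm_iteratedFDeriv_mul_conj_comp_le hF (euclMap (mat h).transpose)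
      (a := fun ξ => auxA O ξ ^ ℓ) hC hNt (fun k hk ξ => hb k (by omega) ξ) hn
      (fun ξ => pow_nonneg (auxA_nonneg O ξ) ℓ) ξ
    rwa [norm_euclMap_transpose] at this) (-x)
  rw [hval, norm_neg] at h1
  rw [waveletTransform_eq_fourierInv hc hi hFi hFc, hx, hh, Real.fourierInv_eq_fourier_neg, norm_mul,
    Complex.norm_real, Real.norm_of_nonneg (Real.rpow_nonneg (absDet_pos h).le _)]
  have hD : 0 ≤ absDet h ^ (1 / 2 : ℝ) := Real.rpow_nonneg (absDet_pos h).le _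
  refine (mul_le_mul_of_nonneg_left h1 hD).trans (le_of_eq ?_)
  rw [mul_pow]
  ring

end WaveletCoorbit

/-! ### Integration over the affine group. -/

namespace WaveletCoorbit
open Filter
variable {d : ℕ} {H : Subgroup (GL (Fin d) ℝ)}

/-- A function on the affine group decaying in the translation variable has finite amalgam norm
as soon as its decay in the dilation variable is controlled. -/
theorem lintegral_localMax_affine_lt_top [LocallyCompactSpace H] [MeasurableSpace H] [BorelSpace H]
    {μ : Measure H} [μ.IsHaarMeasure] {s : ℝ} {N : ℕ} (hNs : s + d < N)
    {w₀ : H → ℝ} (hw₀ : IsWeight w₀) {v₀ : AffineGroup H → ℝ}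
    (hv : ∀ a : AffineGroup H, v₀ a ≤ (1 + ‖a.1‖) ^ s * w₀ a.2)
    {U : Set (AffineGroup H)} (hU : IsCompact U) {F : AffineGroup H → ℂ} {Φ : H → ℂ}
    (hΦ : Continuous Φ) {C : ℝ} (hC : 0 ≤ C)
    (hF : ∀ a : AffineGroup H, ‖F a‖ ≤ C * (absDet a.2 ^ (1 / 2 : ℝ) *
      (1 + ‖euclMap (mat a.2)‖) ^ N) * ‖Φ a.2‖ * ((1 + ‖a.1‖) ^ N)⁻¹)
    {V : Set H} (hUV : ∀ a ∈ U, a.2 ∈ V) (hV : IsCompact V)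
    (hint : ∫⁻ h, localMax V Φ h * ENNReal.ofReal
      (w₀ h * absDet h ^ (-(1 / 2) : ℝ) * (1 + ‖euclMap (mat h)‖) ^ (2 * (N : ℝ))) ∂μ < ∞) :
    ∫⁻ a, localMax U F a * ENNReal.ofReal (v₀ a) ∂(affineHaar μ) < ∞ := by
  obtain ⟨R, hR0, hR⟩ : ∃ R : ℝ, 0 ≤ R ∧ ∀ b ∈ U, ‖b.1‖ ≤ R := by
    have hc : Continuous fun b : AffineGroup H => ‖b.1‖ :=
      (continuous_fst (X := EuclideanSpace ℝ (Fin d)) (Y := H)).norm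
    obtain ⟨R, hR⟩ := (hU.image hc).bddAbove
    exact ⟨max R 0, le_max_right _ _, fun b hb => (hR ⟨b, hb, rfl⟩).trans (le_max_left _ _)⟩
  obtain ⟨Q, hQ0, hQ⟩ : ∃ Q : ℝ, 0 ≤ Q ∧ ∀ g ∈ V,
      absDet g ^ (1 / 2 : ℝ) * (1 + ‖euclMap (mat g)‖) ^ N ≤ Q := by
    have hc : Continuous fun g : H => absDet g ^ (1 / 2 : ℝ) * (1 + ‖euclMap (mat g)‖) ^ N :=
      (continuous_absDet.rpow_const fun h => Or.inr (by norm_num)).mul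
        ((continuous_const.add continuous_euclMap_mat.norm).pow N)
    obtain ⟨Q, hQ⟩ := (hV.image hc).bddAbove
    exact ⟨max Q 0, le_max_right _ _, fun b hb => (hQ ⟨b, hb, rfl⟩).trans (le_max_left _ _)⟩
  set C' := C * Q * (1 + R) ^ N with hC'
  have hC'0 : 0 ≤ C' := by positivity
  -- the pointwise bound for the local maximum function
  have hloc : ∀ a : AffineGroup H, localMax U F a ≤
      ENNReal.ofReal (C' * (absDet a.2 ^ (1 / 2 : ℝ) * (1 + ‖euclMap (mat a.2)‖) ^ (2 * N)) *
        ((1 + ‖a.1‖) ^ N)⁻¹) * localMax V Φ a.2 := by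
    intro a
    refine iSup₂_le fun b hb => ?_
    have hΦb : ‖Φ (a.2 * b.2)‖ₑ ≤ localMax V Φ a.2 :=
      le_iSup₂ (f := fun y _ => ‖Φ (a.2 * y)‖ₑ) b.2 (hUV b hb)
    refine le_trans ?_ (mul_le_mul_right hΦb _)
    have hDa := absDet_pos a.2
    have hDb := absDet_pos b.2
    rw [← ofReal_norm, ← ofReal_norm, ← ENNReal.ofReal_mul (by positivity)]
    refine ENNReal.ofReal_le_ofReal ((hF (a * b)).trans ?_)
    have h1 : (a * b).1 = a.1 + euclMap (mat a.2) b.1 := rfl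
    have h2 : (a * b).2 = a.2 * b.2 := rfl
    rw [h1, h2]
    have e1 : absDet (a.2 * b.2) ^ (1 / 2 : ℝ) * (1 + ‖euclMap (mat (a.2 * b.2))‖) ^ N ≤
        absDet a.2 ^ (1 / 2 : ℝ) * (1 + ‖euclMap (mat a.2)‖) ^ N * Q := by
      calc absDet (a.2 * b.2) ^ (1 / 2 : ℝ) * (1 + ‖euclMap (mat (a.2 * b.2))‖) ^ N
          ≤ (absDet a.2 ^ (1 / 2 : ℝ) * absDet b.2 ^ (1 / 2 : ℝ)) *
            ((1 + ‖euclMap (mat a.2)‖) * (1 + ‖euclMap (mat b.2)‖)) ^ N := by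
            rw [absDet_mul, Real.mul_rpow hDa.le hDb.le]
            gcongr
            exact norm_euclMap_mat_mul_le _ _
        _ = absDet a.2 ^ (1 / 2 : ℝ) * (1 + ‖euclMap (mat a.2)‖) ^ N *
            (absDet b.2 ^ (1 / 2 : ℝ) * (1 + ‖euclMap (mat b.2)‖) ^ N) := by
            rw [mul_pow]; ring
        _ ≤ _ := by gcongr; exact hQ _ (hUV b hb)
    -- The shift `h y` with `‖y‖ ≤ R` costs a second factor `(1 + ‖h‖)^N`; this is the origin of the
    -- exponent `2 * N`.
    have e2 : ((1 + ‖a.1 + euclMap (mat a.2) b.1‖) ^ N)⁻¹ ≤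
        ((1 + ‖a.1‖) ^ N)⁻¹ * ((1 + R) ^ N * (1 + ‖euclMap (mat a.2)‖) ^ N) := by
      refine (one_add_norm_pow_inv_le _ _ _).trans ?_
      rw [← mul_pow]
      gcongr
      have h3 : ‖euclMap (mat a.2) b.1‖ ≤ ‖euclMap (mat a.2)‖ * R :=
        ((euclMap (mat a.2)).le_opNorm _).trans (by gcongr; exact hR b hb)
      nlinarith [norm_nonneg (euclMap (mat a.2))]
    calc C * (absDet (a.2 * b.2) ^ (1 / 2 : ℝ) * (1 + ‖euclMap (mat (a.2 * b.2))‖) ^ N) *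
          ‖Φ (a.2 * b.2)‖ * ((1 + ‖a.1 + euclMap (mat a.2) b.1‖) ^ N)⁻¹
        ≤ C * (absDet a.2 ^ (1 / 2 : ℝ) * (1 + ‖euclMap (mat a.2)‖) ^ N * Q) *
          ‖Φ (a.2 * b.2)‖ *
          (((1 + ‖a.1‖) ^ N)⁻¹ * ((1 + R) ^ N * (1 + ‖euclMap (mat a.2)‖) ^ N)) := by
          gcongr
      _ = _ := by rw [hC', two_mul N, pow_add]; ring
  set P : EuclideanSpace ℝ (Fin d) → ℝ≥0∞ := fun x =>
    ENNReal.ofReal (C' * (1 + ‖x‖) ^ (-((N : ℝ) - s))) with hP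
  set M : H → ℝ≥0∞ := fun h => localMax V Φ h * ENNReal.ofReal
      (w₀ h * absDet h ^ (-(1 / 2) : ℝ) * (1 + ‖euclMap (mat h)‖) ^ (2 * (N : ℝ))) with hM
  -- The variables separate; the Haar density `|det h|⁻¹` turns `|det h|^{1/2}` into the `|det
  -- h|^{-1/2}` of the weight on `H`.
  have hbound : ∀ p : EuclideanSpace ℝ (Fin d) × H,
      ENNReal.ofReal (absDet p.2)⁻¹ * (localMax U F (p : AffineGroup H) *
        ENNReal.ofReal (v₀ (p : AffineGroup H))) ≤ P p.1 * M p.2 := by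
    rintro ⟨x, h⟩
    have hD := absDet_pos h
    have hw := hw₀.pos h
    have h1 := hloc ((x, h) : EuclideanSpace ℝ (Fin d) × H)
    have h2 := ENNReal.ofReal_le_ofReal (hv ((x, h) : EuclideanSpace ℝ (Fin d) × H))
    refine (mul_le_mul_right (mul_le_mul' h1 h2) _).trans (le_of_eq ?_)
    change ENNReal.ofReal (absDet h)⁻¹ *
      (ENNReal.ofReal (C' * (absDet h ^ (1 / 2 : ℝ) * (1 + ‖euclMap (mat h)‖) ^ (2 * N)) *
        ((1 + ‖x‖) ^ N)⁻¹) * localMax V Φ h * ENNReal.ofReal ((1 + ‖x‖) ^ s * w₀ h)) =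
      ENNReal.ofReal (C' * (1 + ‖x‖) ^ (-((N : ℝ) - s))) * (localMax V Φ h * ENNReal.ofReal
      (w₀ h * absDet h ^ (-(1 / 2) : ℝ) * (1 + ‖euclMap (mat h)‖) ^ (2 * (N : ℝ))))
    have e : ∀ (A B C L : ℝ≥0∞), A * (B * L * C) = (A * B * C) * L := by intros; ring
    have e' : ∀ (A B L : ℝ≥0∞), A * (L * B) = (A * B) * L := by intros; ring
    have hP0 : 0 ≤ C' * (1 + ‖x‖) ^ (-((N : ℝ) - s)) := by positivity
    rw [e, e', ← ENNReal.ofReal_mul hP0, ← ENNReal.ofReal_mul (by positivity),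
      ← ENNReal.ofReal_mul (by positivity)]
    congr 2
    have hpow : (1 + ‖x‖) ^ (-((N : ℝ) - s)) = ((1 + ‖x‖) ^ N)⁻¹ * (1 + ‖x‖) ^ s := by
      rw [neg_sub, sub_eq_neg_add, Real.rpow_add (by positivity), Real.rpow_neg (by positivity),
        Real.rpow_natCast]
    have hpow2 : (1 + ‖euclMap (mat h)‖) ^ (2 * (N : ℝ)) = (1 + ‖euclMap (mat h)‖) ^ (2 * N) := by
      rw [← Real.rpow_natCast]; push_cast; rfl
    have hpow3 : absDet h ^ (-(1 / 2) : ℝ) = (absDet h)⁻¹ * absDet h ^ (1 / 2 : ℝ) := by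
      rw [← Real.rpow_neg_one, ← Real.rpow_add hD]; norm_num
    rw [hpow, hpow2, hpow3]
    ring
  have hfacM : Measurable M := (lowerSemicontinuous_localMax V hΦ).measurable.mul
    (ENNReal.measurable_ofReal.comp
      (isWeight_mul_absDet_rpow_mul_norm hw₀ _ (by positivity)).continuous.measurable)
  have hfacP : Measurable P := by
    refine ENNReal.measurable_ofReal.comp (Continuous.measurable ?_)
    exact continuous_const.mul ((continuous_const.add continuous_norm).rpow_const fun x =>
      Or.inl (by positivity : (1 + ‖x‖ : ℝ) ≠ 0))
  have hPfin : ∫⁻ x, P x < ∞ := by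
    simp only [hP, ENNReal.ofReal_mul hC'0]
    rw [lintegral_const_mul' _ _ ENNReal.ofReal_ne_top]
    refine ENNReal.mul_lt_top ENNReal.ofReal_lt_top (finite_integral_one_add_norm ?_)
    rw [finrank_euclideanSpace, Fintype.card_fin]
    linarith
  have hdens : Measurable fun p : EuclideanSpace ℝ (Fin d) × H =>
      ENNReal.ofReal (absDet p.2)⁻¹ := by
    refine ENNReal.measurable_ofReal.comp (Measurable.inv ?_)
    exact continuous_absDet.measurable.comp measurable_snd
  -- An inequality suffices when removing the density, so measurability of `localMax U F` is not
  -- required.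
  calc ∫⁻ a, localMax U F a * ENNReal.ofReal (v₀ a) ∂(affineHaar μ)
      ≤ ∫⁻ p, ENNReal.ofReal (absDet p.2)⁻¹ * (localMax U F (p : AffineGroup H) *
        ENNReal.ofReal (v₀ (p : AffineGroup H)))
        ∂((volume : Measure (EuclideanSpace ℝ (Fin d))).prod μ) :=
        lintegral_withDensity_le_lintegral_mul _ hdens _
    _ ≤ ∫⁻ p, P p.1 * M p.2 ∂((volume : Measure (EuclideanSpace ℝ (Fin d))).prod μ) :=
        lintegral_mono hbound
    _ = (∫⁻ x, P x) * ∫⁻ h, M h ∂μ :=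
        lintegral_prod_mul hfacP.aemeasurable hfacM.aemeasurable
    _ < ∞ := ENNReal.mul_lt_top hPfin hint

end WaveletCoorbit

/-! ### The main theorem. -/

theorem theorem3p3 {d : ℕ} (hd : 0 < d)
    (H : Subgroup (GL (Fin d) ℝ)) (hH : IsClosed (H : Set (GL (Fin d) ℝ)))
    [MeasurableSpace H] [BorelSpace H]
    (μ : Measure H) [μ.IsHaarMeasure]
    (O : Set (EuclideanSpace ℝ (Fin d))) (hO : WaveletCoorbit.IsOpenDualOrbit H O)
    (s : ℝ) (hs : 0 ≤ s)
    (w₀ : H → ℝ) (hw₀ : WaveletCoorbit.IsWeight w₀)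
    (v₀ : WaveletCoorbit.AffineGroup H → ℝ) (hv₀ : WaveletCoorbit.IsWeight v₀)
    (hv₀w₀ : ∀ a : WaveletCoorbit.AffineGroup H, v₀ a ≤ (1 + ‖a.1‖) ^ s * w₀ a.2)
    (W : Set H) (hWc : IsCompact W) (hW : W ∈ 𝓝 (1 : H))
    (U : Set (WaveletCoorbit.AffineGroup H)) (hUc : IsCompact U)
    (hU : U ∈ 𝓝 (1 : WaveletCoorbit.AffineGroup H))
    (ℓ : ℕ) (hℓ : WaveletCoorbit.StronglyTemperatelyEmbedded μ W O s w₀ ℓ)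
    (t : ℕ) (ht : (ℓ : ℝ) + s + d + 1 < t) :
    (∀ ψ : EuclideanSpace ℝ (Fin d) → ℂ, WaveletCoorbit.WaveletCondition O ℓ t ψ →
      WaveletCoorbit.MemNiceWavelets μ U v₀ ψ) ∧
    (∃ ψ : EuclideanSpace ℝ (Fin d) → ℂ, ψ ≠ 0 ∧ HasCompactSupport ψ ∧
      WaveletCoorbit.WaveletCondition O ℓ t ψ) := by
  open WaveletCoorbit in
  refine ⟨fun ψ hψ => ?_, exists_compactlySupported_wavelet hH hO ℓ t⟩
  have hlc : LocallyCompactSpace H := hWc.locallyCompactSpace_of_mem_nhds_of_group hW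
  obtain ⟨hfin, hΦc, hΦi⟩ := hℓ
  -- The integer with `s + d < N ≤ s + d + 1`: the lower bound gives integrability in `x`, the upper
  -- one keeps `2 * N` below the exponent in `m` and, with `ht`, gives `N + ℓ ≤ t`.
  set N := ⌊s⌋₊ + d + 1 with hN
  have hfl : (⌊s⌋₊ : ℝ) ≤ s := Nat.floor_le hs
  have hfl' : s < ⌊s⌋₊ + 1 := Nat.lt_floor_add_one s
  have hNs : s + d < N := by rw [hN]; push_cast; linarith
  have hNs' : (N : ℝ) ≤ s + d + 1 := by rw [hN]; push_cast; linarith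
  have hNt : N + ℓ ≤ t := by
    have : ((N + ℓ : ℕ) : ℝ) < t := by push_cast; linarith
    exact_mod_cast this.le
  have hdt : d < t := by omega
  obtain ⟨hc, -, -, C₀, hC₀⟩ := hψ.regularity hdt
  obtain ⟨C, hC, hdec⟩ := exists_norm_waveletTransform_le hd hO hfin hψ hdt hNt
  refine ⟨memLp_two_of_integrable_of_bounded hψ.1 hC₀,
    continuous_waveletTransform hc hψ.1 ⟨C₀, hC₀⟩, ?_⟩
  have hV : IsCompact ((fun a : AffineGroup H => a.2) '' U) :=
    hUc.image (continuous_snd (X := EuclideanSpace ℝ (Fin d)) (Y := H))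
  have hb : 0 ≤ 2 * (s + d + 1) := by positivity
  -- The embedding condition is given for `W`, while the bound on the affine group requires the
  -- projection of `U` to `H`.
  have hint := lintegral_localMax_lt_top hW hV
    (isWeight_mul_absDet_rpow_mul_norm hw₀ (-(1 / 2)) hb) hΦc hΦi
  refine lintegral_localMax_affine_lt_top hNs hw₀ hv₀w₀ hUc hΦc hC (fun a => ?_)
    (fun a ha => Set.mem_image_of_mem _ ha) hV (lt_of_le_of_lt (lintegral_mono fun h => ?_) hint)
  · rw [Complex.norm_real, Real.norm_of_nonneg ENNReal.toReal_nonneg]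
    exact hdec a
  · refine mul_le_mul_right (ENNReal.ofReal_le_ofReal ?_) _
    have := absDet_pos h
    have := hw₀.pos h
    have hle : (1 : ℝ) ≤ 1 + ‖euclMap (mat h)‖ := by linarith [norm_nonneg (euclMap (mat h))]
    gcongr
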